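/- Let $p,N\in\mathbb N$, and let $\odot$ denote the component-wise product in $\mathbb R^p$. For a locally Lipschitz function $F:\mathbb R^p\to\mathbb R$ let $\partial^\circ F$ denote its Clarke subdifferential, $$\partial^\circ F(x)=\{\xi\in\mathbb R^p:\ \langle \xi,d\rangle\le \limsup_{y\to x,\ h\downarrow 0}\tfrac{F(y+hd)-F(y)}{h}\ \text{ for all } d\in\mathbb R^p\}.$$ **Loss.** Let $f:\mathbb R\to\mathbb R$ be either $f(x)=x$ (exponential loss $e^{-f(x)}=e^{-x}$) or $f(x)=-\log\log(1+e^{-x})$ (logistic loss $e^{-f(x)}=\log(1+e^{-x})$); in both cases $f$ is an increasing bijection of $\mathbb R$. Let $\tilde q_1,\dots,\tilde q_N:\mathbb R^p\to\mathbb R$ and $\tilde{\mathcal L}(v)=\sum_{i=1}^N e^{-f(\tilde q_i(v))}$. Assume: 1. (Regularity) each $\tilde q_i$ is locally Lipschitz and admits a chain rule: for every absolutely continuous curve $z:[a,b]\to\mathbb R^p$ and almost every $t\in[a,b]$, $\frac{d}{dt}\tilde q_i(z(t))=\langle\xi,z'(t)\rangle$ for all $\xi\in\partial^\circ\tilde q_i(z(t))$;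 2. (Homogeneity) there is $L>0$ such that $\tilde q_i(\alpha v)=\alpha^L\tilde q_i(v)$ for all $\alpha>0$, all $v\in\mathbb R^p$ and all $i$. **Flow.** Let $v:[0,\infty)\to\mathbb R^p$ obey an adaptive gradient flow with loss $\tilde{\mathcal L}$ and component learning rate $\beta:[0,\infty)\to(0,\infty)^p$. That is, $v$ is absolutely continuous on every compact time interval and, for almost every $t\ge 0$, $$\frac{dv(t)}{dt}=-\beta(t)\odot\xi(t)\quad\text{for some }\xi(t)\in\partial^\circ\tilde{\mathcal L}(v(t));$$ moreover $\lim_{t\to\infty}\beta(t)=(1,\dots,1)$, each $\log\beta_j$ is absolutely continuous on every compact time interval, and its derivative $\frac{d\log\beta_j}{dt}$ is Lebesgue integrable on $[0,\infty)$. 3. (Separability) Assume that there is a time $t_0\ge0$ with $f^{-1}\bigl(\log\frac1{\tilde{\mathcal L}(v(t_0))}\bigr)>0$. Then every limit point $\bar v$ of $v(t)/\|v(t)\|$ as $t\to\infty$ is along the direction of a KKT point of the max-margin problem $$\min_{x\in\mathbb R^p}\ \tfrac12\|x\|^2\quad\text{subject to}\quad \tilde q_i(x)\ge1,\ i=1,\dots,N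 ;$$ that is, there is $c>0$ such that $x=c\bar v$ is a KKT point. Here a KKT point of "$\min F$ subject to $g_i\le0$ for all $i$", with $F,g_i$ locally Lipschitz, is a point $x$ with $g_i(x)\le 0$ for all $i$ for which there are reals $\lambda_i\ge0$ and vectors $\kappa\in\partial^\circ F(x)$, $\eta_i\in\partial^\circ g_i(x)$ with $\kappa+\sum_{i}\lambda_i\eta_i=0$ and $\lambda_i g_i(x)=0$ for all $i$; it is applied with $F(x)=\frac12\|x\|^2$ and $g_i=1-\tilde q_i$. -/

import Mathlib

open Filter Topology MeasureTheory Set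

namespace AdaptiveFlow

/-- Parameter space `ℝ^p` with the Euclidean norm. -/
abbrev Param (p : ℕ) : Type := EuclideanSpace ℝ (Fin p)

/-! ### Clarke's subdifferential -/

/-- Clarke's generalized directional derivative
`f°(x; d) = limsup_{y → x, h ↓ 0} (f (y + h d) - f y) / h`.
For locally Lipschitz `f` (the only functions it is used for) the quotients are bounded near the
limit, so the real-valued `limsup` is the true one. -/
noncomputable def clarkeDirDeriv {p : ℕ} (f : Param p → ℝ) (x d : Param p) : ℝ :=
  limsup (fun z : Param p × ℝ => (f (z.1 + z.2 • d) - f z.1) / z.2) (𝓝 x ×ˢ 𝓝[>] (0 : ℝ))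

/-- Clarke's subdifferential `∂°f(x) = {ξ | ⟨ξ, d⟩ ≤ f°(x; d) for all d}`. -/
def clarkeSubdiff {p : ℕ} (f : Param p → ℝ) (x : Param p) : Set (Param p) :=
  {ξ | ∀ d : Param p, inner ℝ ξ d ≤ clarkeDirDeriv f x d}

/-- `f` admits a chain rule: along every absolutely continuous curve `z : [a, b] → ℝ^p`, for almost
every time `t`, `(f ∘ z)'(t) = ⟨ξ, z'(t)⟩` for all `ξ ∈ ∂°f(z(t))`. -/
def AdmitsChainRule {p : ℕ} (f : Param p → ℝ) : Prop :=
  ∀ (z : ℝ → Param p) (a b : ℝ), a ≤ b → AbsolutelyContinuousOnInterval z a b →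
    ∀ᵐ t ∂(volume.restrict (Icc a b)), ∀ ξ ∈ clarkeSubdiff f (z t), ∀ z' : Param p,
      HasDerivAt z z' t → HasDerivAt (fun s => f (z s)) (inner ℝ ξ z') t

/-! ### The loss -/

/-- The two individual losses `ℓ = e^{-f}` under consideration. -/
inductive LossKind : Type
  | exponential
  | logistic

/-- The function `f` with `ℓ = e^{-f}`: `f(x) = x` for the exponential loss `e^{-x}`,
`f(x) = -log log (1 + e^{-x})` for the logistic loss `log (1 + e^{-x})`. -/
noncomputable def LossKind.f : LossKind → ℝ → ℝ
  | .exponential, x => x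
  | .logistic, x => -Real.log (Real.log (1 + Real.exp (-x)))

/-- The inverse function `f⁻¹` of `f` (see `LossKind.finv_f` and `LossKind.f_finv`). -/
noncomputable def LossKind.finv : LossKind → ℝ → ℝ
  | .exponential, y => y
  | .logistic, y => -Real.log (Real.exp (Real.exp (-y)) - 1)

theorem LossKind.finv_f (k : LossKind) (x : ℝ) : k.finv (k.f x) = x := by
  cases k with
  | exponential => rfl
  | logistic =>
    have h1 : (0 : ℝ) < 1 + Real.exp (-x) := by positivity
    have h2 : 0 < Real.log (1 + Real.exp (-x)) :=
      Real.log_pos (by linarith [Real.exp_pos (-x)])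
    simp only [LossKind.f, LossKind.finv, neg_neg]
    rw [Real.exp_log h2, Real.exp_log h1]
    simp

theorem LossKind.f_finv (k : LossKind) (y : ℝ) : k.f (k.finv y) = y := by
  cases k with
  | exponential => rfl
  | logistic =>
    have h1 : 0 < Real.exp (Real.exp (-y)) - 1 := by
      have := Real.add_one_lt_exp (Real.exp_pos (-y)).ne'
      linarith [Real.exp_pos (-y)]
    simp only [LossKind.f, LossKind.finv, neg_neg]
    rw [Real.exp_log h1]
    simp

/-- The empirical loss `𝓛(w) = ∑ᵢ e^{-f(qᵢ(w))}`. -/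
noncomputable def empLoss {p N : ℕ} (k : LossKind) (q : Fin N → Param p → ℝ) (w : Param p) : ℝ :=
  ∑ i, Real.exp (-k.f (q i w))

/-! ### Adaptive gradient flows -/

/-- Component-wise product of vectors. -/
noncomputable def hadamard {p : ℕ} (x y : Param p) : Param p :=
  WithLp.toLp 2 (fun j => x j * y j)

/-- `v : [0, ∞) → ℝ^p` obeys an adaptive gradient flow with loss `𝓛` and component learning rate
`β`.  Values of `v` and `β` at negative times are irrelevant. -/
structure IsAdaptiveGradientFlow {p : ℕ} (𝓛 : Param p → ℝ) (β v : ℝ → Param p) : Prop where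
  /-- `v` is absolutely continuous on compact time intervals -/
  ac : ∀ T, 0 ≤ T → AbsolutelyContinuousOnInterval v 0 T
  /-- `dv/dt = -β ⊙ ξ` with `ξ ∈ ∂°𝓛(v)`, for almost every time -/
  flow : ∀ᵐ t ∂(volume.restrict (Ici (0 : ℝ))), ∃ ξ ∈ clarkeSubdiff 𝓛 (v t),
    HasDerivAt v (-hadamard (β t) ξ) t
  /-- the learning rates are positive, so that `log β` makes sense -/
  rate_pos : ∀ t, 0 ≤ t → ∀ j, 0 < β t j
  /-- `β(t) → (1, …, 1)` -/
  rate_tendsto : ∀ j, Tendsto (fun t => β t j) atTop (𝓝 1)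
  /-- `log β` is absolutely continuous on compact time intervals -/
  log_rate_ac : ∀ j, ∀ T, 0 ≤ T →
    AbsolutelyContinuousOnInterval (fun t => Real.log (β t j)) 0 T
  /-- `d log β / dt` is Lebesgue integrable -/
  log_rate_integrable : ∀ j,
    IntegrableOn (deriv (fun t => Real.log (β t j))) (Ici (0 : ℝ)) volume

/-! ### Karush–Kuhn–Tucker points -/

/-- `x` is a KKT point of the problem `min F` subject to `gᵢ ≤ 0` for all `i`, where `F` and the
`gᵢ` are locally Lipschitz. -/
def IsKKTPoint {p N : ℕ} (F : Param p → ℝ) (g : Fin N → Param p → ℝ) (x : Param p) : Prop :=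
  (∀ i, g i x ≤ 0) ∧
  ∃ (lam : Fin N → ℝ) (κ : Param p) (η : Fin N → Param p),
    (∀ i, 0 ≤ lam i) ∧ κ ∈ clarkeSubdiff F x ∧ (∀ i, η i ∈ clarkeSubdiff (g i) x) ∧
    κ + ∑ i, lam i • η i = 0 ∧ ∀ i, lam i * g i x = 0

/-- `x` is a KKT point of the max-margin problem
`min ½‖v‖²` subject to `qᵢ(v) ≥ 1` (that is, `1 - qᵢ(v) ≤ 0`) for all `i`. -/
def IsMaxMarginKKTPoint {p N : ℕ} (q : Fin N → Param p → ℝ) (x : Param p) : Prop :=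
  IsKKTPoint (fun v => (1 / 2 : ℝ) * ‖v‖ ^ 2) (fun i v => 1 - q i v) x

end AdaptiveFlow

open AdaptiveFlow

/-! Let `S = ℓ⁻¹(𝓛)` be the smoothed margin, `w = -ℓ'`, `R = log ‖β^{-1/2} ⊙ v‖`, `n = -⟨ξ, v⟩` and
`A = ∑ βⱼ ξⱼ² = -d𝓛/dt`. The factor `β^{-1/2}` cancels the learning rate, so `R' = n e^{-2R}` up to
an error bounded by the integrable rate `b = ∑ |(log βⱼ)'|`, with primitive `B`
(`hasDerivAt_logRadius`). Euler's identity and the monotonicity of `f' = w / ℓ` give `L w(S) S ≤ n`;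
Cauchy–Schwarz gives `n² e^{-2R} ≤ A`. Hence `(log S)' = A / (w(S) S) ≥ L A / n ≥ L n e^{-2R}`, and
the potential `log S - L R + (L/2) B` is nondecreasing. It is bounded above because `S ≤ qᵢ ≤ M e^{L
R}`. So the normalized margins stay bounded below, `S` and `R` tend to infinity, and the accumulated
Cauchy–Schwarz defect is finite (`MarginDynamics`).

After a late time at which the direction is near `v̄`, let the clock `R + B/2` advance by a small
fixed amount. The potential gains almost nothing there, so somewhere in this window Cauchy–Schwarz
is nearly an equality; meanwhile `v e^{-R}` has hardly moved, its speed being controlled by the same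
clock (`exists_aligned`). Near-equality forces `ξ` to be nearly antiparallel to `β⁻¹ ⊙ v`, hence to
`v̄`, as `β → 1` (`coordinate_defect_sq_le`).

Finally `ξ = -∑ w(qᵢ) hᵢ` with `hᵢ ∈ ∂°qᵢ`. After normalization the coefficients and the `hᵢ` lie in
a compact set, and a limit gives stationarity. Since `w` decays exponentially, only constraints of
minimal margin keep a multiplier (`exists_isMaxMarginKKTPoint_of_tendsto`). -/

namespace AdaptiveFlow

variable {p N : ℕ}

/-! ### Clarke calculus -/

/-- The difference quotient whose limsup is Clarke's directional derivative. -/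
noncomputable def diffQuot (f : Param p → ℝ) (d : Param p) (z : Param p × ℝ) : ℝ :=
  (f (z.1 + z.2 • d) - f z.1) / z.2

/-- The filter `y → x, h ↓ 0`. -/
abbrev clarkeFilter (x : Param p) : Filter (Param p × ℝ) := 𝓝 x ×ˢ 𝓝[>] (0 : ℝ)

theorem clarkeFilter_eventually_pos (x : Param p) : ∀ᶠ z in clarkeFilter x, 0 < z.2 :=
  tendsto_snd.eventually (self_mem_nhdsWithin : Ioi (0 : ℝ) ∈ 𝓝[>] (0 : ℝ))

theorem tendsto_fst_clarkeFilter (x : Param p) : Tendsto Prod.fst (clarkeFilter x) (𝓝 x) :=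
  tendsto_fst

theorem tendsto_snd_clarkeFilter (x : Param p) :
    Tendsto Prod.snd (clarkeFilter x) (𝓝 (0 : ℝ)) :=
  tendsto_snd.mono_right nhdsWithin_le_nhds

theorem tendsto_add_smul_clarkeFilter (x d : Param p) :
    Tendsto (fun z : Param p × ℝ => z.1 + z.2 • d) (clarkeFilter x) (𝓝 x) := by
  simpa using (tendsto_fst_clarkeFilter x).add ((tendsto_snd_clarkeFilter x).smul_const d)

theorem tendsto_clarkeFilter {α : Type*} {l : Filter α} {x : Param p} {a : α → Param p}
    {h : α → ℝ} (ha : Tendsto a l (𝓝 x)) (h0 : Tendsto h l (𝓝 0)) (hpos : ∀ᶠ z in l, 0 < h z) :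
    Tendsto (fun z => (a z, h z)) l (clarkeFilter x) :=
  ha.prodMk (tendsto_nhdsWithin_iff.2 ⟨h0, hpos⟩)

theorem eventually_abs_sub_le {f : Param p → ℝ} (hf : LocallyLipschitz f) (x : Param p) :
    ∃ K : ℝ, 0 ≤ K ∧ ∀ᶠ y in 𝓝 x, ∀ d : Param p, ∀ᶠ z in clarkeFilter y,
      |f (z.1 + z.2 • d) - f z.1| ≤ K * ‖d‖ * z.2 := by
  obtain ⟨K, t, ht, hK⟩ := hf x
  refine ⟨K, K.2, ?_⟩
  filter_upwards [eventually_mem_nhds_iff.2 ht] with y hy d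
  filter_upwards [(tendsto_add_smul_clarkeFilter y d).eventually hy,
    (tendsto_fst_clarkeFilter y).eventually hy, clarkeFilter_eventually_pos y] with z h1 h2 h3
  have := hK.dist_le_mul _ h1 _ h2
  rw [Real.dist_eq, dist_eq_norm, add_sub_cancel_left, norm_smul, Real.norm_of_nonneg h3.le] at this
  linarith

theorem eventually_abs_diffQuot_le {f : Param p → ℝ} (hf : LocallyLipschitz f) (x : Param p) :
    ∃ K : ℝ, 0 ≤ K ∧ ∀ᶠ y in 𝓝 x, ∀ d : Param p, ∀ᶠ z in clarkeFilter y,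
      |diffQuot f d z| ≤ K * ‖d‖ := by
  obtain ⟨K, hK, h⟩ := eventually_abs_sub_le hf x
  refine ⟨K, hK, ?_⟩
  filter_upwards [h] with y hy d
  filter_upwards [hy d, clarkeFilter_eventually_pos y] with z h1 h3
  rw [diffQuot, abs_div, abs_of_pos h3, div_le_iff₀ h3]
  exact h1

theorem clarkeDirDeriv_le {f : Param p → ℝ} (hf : LocallyLipschitz f) {x d : Param p} {c : ℝ}
    (h : ∀ᶠ z in clarkeFilter x, diffQuot f d z ≤ c) : clarkeDirDeriv f x d ≤ c := by
  obtain ⟨K, -, hK⟩ := eventually_abs_diffQuot_le hf x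
  refine limsup_le_of_le ?_ h
  refine IsBoundedUnder.isCoboundedUnder_le ⟨-(K * ‖d‖), ?_⟩
  exact (hK.self_of_nhds d).mono fun z hz => (abs_le.1 hz).1

theorem eventually_diffQuot_le {f : Param p → ℝ} (hf : LocallyLipschitz f) {x d : Param p} {c : ℝ}
    (h : clarkeDirDeriv f x d < c) : ∀ᶠ z in clarkeFilter x, diffQuot f d z ≤ c := by
  obtain ⟨K, -, hK⟩ := eventually_abs_diffQuot_le hf x
  refine (eventually_lt_of_limsup_lt h ⟨K * ‖d‖, ?_⟩).mono fun z hz => le_of_lt hz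
  exact (hK.self_of_nhds d).mono fun z hz => (abs_le.1 hz).2

/-- Local Lipschitz continuity bounds the quotients, so the real-valued `limsup` is not a junk value
and can be traded for eventual upper bounds, which transfer easily along changes of variables in
`(y, h)`. -/
theorem le_clarkeDirDeriv_iff {f : Param p → ℝ} (hf : LocallyLipschitz f) {x d : Param p} {a : ℝ} :
    a ≤ clarkeDirDeriv f x d ↔
      ∀ c, (∀ᶠ z in clarkeFilter x, diffQuot f d z ≤ c) → a ≤ c := by
  refine ⟨fun h c hc => h.trans (clarkeDirDeriv_le hf hc), fun h => ?_⟩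
  refine le_of_forall_gt_imp_ge_of_dense fun c hc => h c (eventually_diffQuot_le hf hc)

theorem mem_clarkeSubdiff_iff {f : Param p → ℝ} (hf : LocallyLipschitz f) {x ξ : Param p} :
    ξ ∈ clarkeSubdiff f x ↔
      ∀ d c, (∀ᶠ z in clarkeFilter x, diffQuot f d z ≤ c) → inner ℝ ξ d ≤ c := by
  simp only [clarkeSubdiff, mem_ofPred_eq, le_clarkeDirDeriv_iff hf]

theorem exists_norm_clarkeSubdiff_le {f : Param p → ℝ} (hf : LocallyLipschitz f) (x : Param p) :
    ∃ K : ℝ, 0 ≤ K ∧ ∀ᶠ y in 𝓝 x, ∀ ξ ∈ clarkeSubdiff f y, ‖ξ‖ ≤ K := by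
  obtain ⟨K, hK0, hK⟩ := eventually_abs_diffQuot_le hf x
  refine ⟨K, hK0, ?_⟩
  filter_upwards [hK] with y hy ξ hξ
  have := (mem_clarkeSubdiff_iff hf).1 hξ ξ _ ((hy ξ).mono fun z hz => (abs_le.1 hz).2)
  rw [real_inner_self_eq_norm_sq] at this
  by_contra hlt
  push Not at hlt
  nlinarith [norm_nonneg ξ]

/-- Closed graph of the subdifferential: an upper bound on the quotients near `x` is also an upper
bound near every point close to `x`, with the same range of `h`. -/
theorem mem_clarkeSubdiff_of_tendsto {α : Type*} {l : Filter α} [l.NeBot] {f : Param p → ℝ}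
    (hf : LocallyLipschitz f) {x ξ : Param p} {X Ξ : α → Param p} (hX : Tendsto X l (𝓝 x))
    (hΞ : Tendsto Ξ l (𝓝 ξ)) (h : ∀ᶠ m in l, Ξ m ∈ clarkeSubdiff f (X m)) :
    ξ ∈ clarkeSubdiff f x := by
  rw [mem_clarkeSubdiff_iff hf]
  intro d c hc
  obtain ⟨P, hP, Q, hQ, hPQ⟩ := eventually_prod_iff.1 hc
  have hc' : ∀ᶠ y in 𝓝 x, ∀ᶠ z in clarkeFilter y, diffQuot f d z ≤ c := by
    filter_upwards [eventually_eventually_nhds.2 hP] with y hy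
    exact eventually_prod_iff.2 ⟨P, hy, Q, hQ, hPQ⟩
  refine le_of_tendsto (hΞ.inner tendsto_const_nhds) ?_
  filter_upwards [h, hX.eventually hc'] with m h1 h2
  exact (mem_clarkeSubdiff_iff hf).1 h1 d c h2

/-- The substitution `(y, h) ↦ (α y, α h)` multiplies difference quotients by `α ^ (L - 1)`. -/
theorem smul_mem_clarkeSubdiff_smul {f : Param p → ℝ} (hf : LocallyLipschitz f) {L : ℝ}
    (hhom : ∀ α : ℝ, 0 < α → ∀ x, f (α • x) = α ^ L * f x) {α : ℝ} (hα : 0 < α) {x ξ : Param p}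
    (hξ : ξ ∈ clarkeSubdiff f x) : α ^ (L - 1) • ξ ∈ clarkeSubdiff f (α • x) := by
  rw [mem_clarkeSubdiff_iff hf] at hξ ⊢
  intro d c hc
  have hαp : 0 < α ^ (L - 1) := Real.rpow_pos_of_pos hα _
  have ht : Tendsto (fun z : Param p × ℝ => (α • z.1, α * z.2)) (clarkeFilter x)
      (clarkeFilter (α • x)) := by
    refine tendsto_clarkeFilter ((tendsto_fst_clarkeFilter x).const_smul α) ?_ ?_
    · simpa using (tendsto_snd_clarkeFilter x).const_mul α
    · filter_upwards [clarkeFilter_eventually_pos x] with z hz using mul_pos hα hz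
  have := hξ d (c / α ^ (L - 1)) ?_
  · rw [real_inner_smul_left]
    rwa [le_div_iff₀ hαp, mul_comm] at this
  · filter_upwards [ht.eventually hc, clarkeFilter_eventually_pos x] with z hz hz0
    rw [le_div_iff₀ hαp]
    refine le_trans (le_of_eq ?_) hz
    simp only [diffQuot]
    rw [mul_smul, ← smul_add, hhom α hα, hhom α hα]
    have : α ^ L = α ^ (L - 1) * α := by
      rw [← Real.rpow_add_one hα.ne', sub_add_cancel]
    rw [this]
    field_simp

/-- Moving the base point from `y` to `y - h d` turns a quotient of `a - f` in direction `d` into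
one of `f` in direction `-d`. -/
theorem neg_mem_clarkeSubdiff_const_sub {f : Param p → ℝ} (hf : LocallyLipschitz f) (a : ℝ)
    {x ξ : Param p} (hξ : ξ ∈ clarkeSubdiff f x) :
    -ξ ∈ clarkeSubdiff (fun y => a - f y) x := by
  have hg : LocallyLipschitz (fun y => a - f y) := (LocallyLipschitz.const a).sub hf
  rw [mem_clarkeSubdiff_iff hg]
  intro d c hc
  have ht : Tendsto (fun z : Param p × ℝ => (z.1 + z.2 • -d, z.2)) (clarkeFilter x)
      (clarkeFilter x) :=
    tendsto_clarkeFilter (tendsto_add_smul_clarkeFilter x (-d)) (tendsto_snd_clarkeFilter x)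
      (clarkeFilter_eventually_pos x)
  have := (mem_clarkeSubdiff_iff hf).1 hξ (-d) c ?_
  · simpa using this
  · filter_upwards [ht.eventually hc] with z hz
    refine le_trans (le_of_eq ?_) hz
    simp [diffQuot]

theorem self_mem_clarkeSubdiff_half_norm_sq (x : Param p) :
    x ∈ clarkeSubdiff (fun v : Param p => (1 / 2 : ℝ) * ‖v‖ ^ 2) x := by
  intro d
  have h : Tendsto (fun z : Param p × ℝ => inner ℝ z.1 d + z.2 * ((1 / 2) * ‖d‖ ^ 2))
      (clarkeFilter x) (𝓝 (inner ℝ x d)) := by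
    simpa using ((tendsto_fst_clarkeFilter x).inner tendsto_const_nhds).add
      ((tendsto_snd_clarkeFilter x).mul_const ((1 / 2) * ‖d‖ ^ 2))
  refine le_of_eq (Tendsto.limsup_eq (h.congr' ?_)).symm
  filter_upwards [clarkeFilter_eventually_pos x] with z hz
  rw [norm_add_sq_real, real_inner_smul_right, norm_smul, Real.norm_of_nonneg hz.le]
  field_simp
  ring

theorem clarkeDirDeriv_smul {f : Param p → ℝ} (hf : LocallyLipschitz f) (x : Param p) {a : ℝ}
    (ha : 0 < a) (d : Param p) : clarkeDirDeriv f x (a • d) = a * clarkeDirDeriv f x d := by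
  have key : ∀ (a : ℝ), 0 < a → ∀ d : Param p,
      clarkeDirDeriv f x (a • d) ≤ a * clarkeDirDeriv f x d := by
    intro a ha d
    rw [← div_le_iff₀' ha]
    refine le_of_forall_gt_imp_ge_of_dense fun c hc => ?_
    rw [div_le_iff₀' ha]
    refine clarkeDirDeriv_le hf ?_
    have ht : Tendsto (fun z : Param p × ℝ => (z.1, a * z.2)) (clarkeFilter x)
        (clarkeFilter x) := by
      refine tendsto_clarkeFilter (tendsto_fst_clarkeFilter x) ?_ ?_
      · simpa using (tendsto_snd_clarkeFilter x).const_mul a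
      · filter_upwards [clarkeFilter_eventually_pos x] with z hz using mul_pos ha hz
    filter_upwards [ht.eventually (eventually_diffQuot_le hf hc)] with z hz
    rw [← div_le_iff₀' ha]
    refine le_trans (le_of_eq ?_) hz
    simp only [diffQuot, smul_smul]
    rw [div_div, mul_comm z.2 a]
  refine le_antisymm (key a ha d) ?_
  have := key a⁻¹ (inv_pos.2 ha) (a • d)
  rw [smul_smul, inv_mul_cancel₀ ha.ne', one_smul] at this
  rwa [le_inv_mul_iff₀ ha] at this

/-- The quotient telescopes through `y + h e`, an admissible base point since it also tends to `x`.
With positive homogeneity this is the sublinearity needed for Hahn–Banach. -/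
theorem clarkeDirDeriv_add_le {f : Param p → ℝ} (hf : LocallyLipschitz f) (x d e : Param p) :
    clarkeDirDeriv f x (d + e) ≤ clarkeDirDeriv f x d + clarkeDirDeriv f x e := by
  refine le_of_forall_pos_le_add fun ε hε => clarkeDirDeriv_le hf ?_
  have h1 := eventually_diffQuot_le hf (show clarkeDirDeriv f x d < clarkeDirDeriv f x d + ε / 2 by
    linarith)
  have h2 := eventually_diffQuot_le hf (show clarkeDirDeriv f x e < clarkeDirDeriv f x e + ε / 2 by
    linarith)
  have ht : Tendsto (fun z : Param p × ℝ => (z.1 + z.2 • e, z.2)) (clarkeFilter x)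
      (clarkeFilter x) :=
    tendsto_clarkeFilter (tendsto_add_smul_clarkeFilter x e) (tendsto_snd_clarkeFilter x)
      (clarkeFilter_eventually_pos x)
  filter_upwards [ht.eventually h1, h2] with z hz1 hz2
  have : diffQuot f (d + e) z = diffQuot f d (z.1 + z.2 • e, z.2) + diffQuot f e z := by
    simp only [diffQuot]
    rw [← add_div, smul_add, add_assoc, add_comm (z.2 • e)]
    ring
  rw [this]
  linarith

/-- The estimate underlying the chain and sum rules for `∑ᵢ φ ∘ qᵢ` with `φ` decreasing. -/
theorem clarkeDirDeriv_sum_comp_le {q : Fin N → Param p → ℝ} (hq : ∀ i, LocallyLipschitz (q i))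
    {φ w : ℝ → ℝ} (hφ : ∀ a, HasStrictDerivAt φ (-w a) a) (hw : ∀ a, 0 < w a)
    (hF : LocallyLipschitz fun x => ∑ i, φ (q i x)) (x d : Param p) :
    clarkeDirDeriv (fun x => ∑ i, φ (q i x)) x d ≤
      ∑ i, w (q i x) * clarkeDirDeriv (q i) x (-d) := by
  refine le_of_forall_pos_le_add fun ε hε => clarkeDirDeriv_le hF ?_
  have hterm : ∀ δ : ℝ, 0 < δ → ∀ i, ∀ᶠ z in clarkeFilter x,
      diffQuot (fun y => φ (q i y)) d z ≤ w (q i x) * clarkeDirDeriv (q i) x (-d) + δ := by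
    intro δ hδ i
    obtain ⟨K, hK0, hK⟩ := eventually_abs_sub_le (hq i) x
    have hKd := hK.self_of_nhds d
    -- Half of `δ` pays for the strict-derivative error of `φ`, half for approximating the limsup.
    -- The `+ 1` avoids division by zero.
    set η : ℝ := δ / 2 / (K * ‖d‖ + 1) with hη
    have hden : 0 < K * ‖d‖ + 1 := by positivity
    have hη0 : 0 < η := by positivity
    have hc : Tendsto (fun z : Param p × ℝ => (q i (z.1 + z.2 • d), q i z.1)) (clarkeFilter x)
        (𝓝 (q i x, q i x)) := by
      have := (hq i).continuous.tendsto x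
      exact (this.comp (tendsto_add_smul_clarkeFilter x d)).prodMk_nhds
        (this.comp (tendsto_fst_clarkeFilter x))
    have hstrict := hc.eventually ((hφ (q i x)).isLittleO.def hη0)
    set C := clarkeDirDeriv (q i) x (-d) with hC
    have h1 := eventually_diffQuot_le (hq i) (show C < C + δ / 2 / w (q i x) from
      lt_add_of_pos_right _ (div_pos (half_pos hδ) (hw _)))
    -- As `φ` decreases, the increment of `q i` enters with a minus sign: it is read backwards, from
    -- `y + h d` in direction `-d`.
    have ht : Tendsto (fun z : Param p × ℝ => (z.1 + z.2 • d, z.2)) (clarkeFilter x)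
        (clarkeFilter x) :=
      tendsto_clarkeFilter (tendsto_add_smul_clarkeFilter x d) (tendsto_snd_clarkeFilter x)
        (clarkeFilter_eventually_pos x)
    filter_upwards [hKd, hstrict, ht.eventually h1, clarkeFilter_eventually_pos x]
      with z hz1 hz2 hz3 hz0
    simp only [diffQuot] at hz3 ⊢
    rw [div_le_iff₀ hz0] at hz3 ⊢
    have e : z.1 + z.2 • d + z.2 • -d = z.1 := by simp
    rw [e] at hz3
    simp only [Real.norm_eq_abs, ContinuousLinearMap.toSpanSingleton_apply, smul_eq_mul] at hz2
    have hz2' := (abs_le.1 hz2).2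
    have h4 : η * |q i (z.1 + z.2 • d) - q i z.1| ≤ δ / 2 * z.2 := by
      calc η * |q i (z.1 + z.2 • d) - q i z.1| ≤ η * (K * ‖d‖ * z.2) := by gcongr
        _ ≤ η * ((K * ‖d‖ + 1) * z.2) := by gcongr; linarith
        _ = δ / 2 * z.2 := by rw [hη]; field_simp
    have h5 := mul_le_mul_of_nonneg_left hz3 (hw (q i x)).le
    have h6 : w (q i x) * ((C + δ / 2 / w (q i x)) * z.2) = (w (q i x) * C + δ / 2) * z.2 := by
      have := (hw (q i x)).ne'
      field_simp
    nlinarith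
  have hδ : 0 < ε / (N + 1) := by positivity
  filter_upwards [eventually_all.2 (hterm _ hδ)] with z hz
  have : diffQuot (fun x => ∑ i, φ (q i x)) d z = ∑ i, diffQuot (fun y => φ (q i y)) d z := by
    simp only [diffQuot]
    rw [← Finset.sum_sub_distrib, Finset.sum_div]
  rw [this]
  refine (Finset.sum_le_sum fun i _ => hz i).trans ?_
  rw [Finset.sum_add_distrib]
  gcongr
  simp only [Finset.sum_const, Finset.card_univ, Fintype.card_fin, nsmul_eq_mul]
  rw [mul_div_assoc', div_le_iff₀ (by positivity)]
  nlinarith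

/-- Chain and sum rule: a Clarke subgradient of `∑ᵢ φ ∘ qᵢ`, with `φ' = -w < 0`, is
`-∑ᵢ w(qᵢ) hᵢ` for Clarke subgradients `hᵢ` of the `qᵢ`. -/
theorem exists_clarkeSubdiff_sum_comp {q : Fin N → Param p → ℝ}
    (hq : ∀ i, LocallyLipschitz (q i)) {φ w : ℝ → ℝ} (hφ : ∀ a, HasStrictDerivAt φ (-w a) a)
    (hw : ∀ a, 0 < w a) (hF : LocallyLipschitz fun x => ∑ i, φ (q i x)) (hN : 0 < N)
    {x ξ : Param p} (hξ : ξ ∈ clarkeSubdiff (fun x => ∑ i, φ (q i x)) x) :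
    ∃ h : Fin N → Param p, (∀ i, h i ∈ clarkeSubdiff (q i) x) ∧
      ξ = -∑ i, w (q i x) • h i := by
  -- Hahn–Banach on the product space: `⟨ξ, ·⟩` on the diagonal is dominated by the sublinear `P`.
  -- The coordinates of an extension, divided by `-w (q i x)`, are the required subgradients.
  let P : (Fin N → Param p) → ℝ := fun D => ∑ i, w (q i x) * clarkeDirDeriv (q i) x (-D i)
  let diag : Param p →ₗ[ℝ] (Fin N → Param p) := LinearMap.pi fun _ => LinearMap.id
  let i₀ : Fin N := ⟨0, hN⟩
  let ψ : (Fin N → Param p) →ₗ[ℝ] ℝ := (innerₗ (Param p) ξ).comp (LinearMap.proj i₀)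
  obtain ⟨g, hg1, hg2⟩ := exists_extension_of_le_sublinear
    ⟨LinearMap.range diag, ψ.domRestrict _⟩ P
    (fun c hc D => by
      simp only [P, Finset.mul_sum]
      refine Finset.sum_congr rfl fun i _ => ?_
      rw [Pi.smul_apply, ← smul_neg, clarkeDirDeriv_smul (hq i) x hc]
      ring)
    (fun D E => by
      simp only [P, ← Finset.sum_add_distrib]
      refine Finset.sum_le_sum fun i _ => ?_
      rw [← mul_add, Pi.add_apply, neg_add]
      exact mul_le_mul_of_nonneg_left (clarkeDirDeriv_add_le (hq i) x _ _) (hw _).le)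
    (by
      rintro ⟨_, d, rfl⟩
      exact (hξ d).trans (clarkeDirDeriv_sum_comp_le hq hφ hw hF x d))
  have hP0 : ∀ i, clarkeDirDeriv (q i) x 0 = 0 := by
    intro i
    have := clarkeDirDeriv_smul (hq i) x two_pos 0
    rw [smul_zero] at this
    linarith
  let G : Fin N → Param p := fun i => (InnerProductSpace.toDual ℝ (Param p)).symm
    (LinearMap.toContinuousLinearMap (g.comp (LinearMap.single ℝ (fun _ => Param p) i)))
  have hG : ∀ i d, inner ℝ (G i) d = g (Pi.single i d) := by
    intro i d
    simp [G]
  refine ⟨fun i => -(w (q i x))⁻¹ • G i, fun i d => ?_, ?_⟩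
  · have h1 := hg2 (Pi.single i (-d))
    have h2 : P (Pi.single i (-d)) = w (q i x) * clarkeDirDeriv (q i) x d := by
      simp only [P]
      rw [Finset.sum_eq_single i]
      · simp
      · intro j _ hj
        simp [Pi.single_eq_of_ne hj, hP0]
      · simp
    rw [h2, ← hG, inner_neg_right] at h1
    rw [real_inner_smul_left, neg_mul, ← mul_neg, inv_mul_le_iff₀ (hw _)]
    exact h1
  · refine ext_inner_right ℝ fun d => ?_
    have h1 : g (diag d) = inner ℝ ξ d := hg1 ⟨diag d, ⟨d, rfl⟩⟩
    have h2 : diag d = ∑ i, Pi.single i d := by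
      ext j
      simp [diag, Finset.sum_apply, Pi.single_apply]
    rw [← h1, h2, map_sum, ← Finset.sum_neg_distrib, sum_inner]
    refine Finset.sum_congr rfl fun i _ => ?_
    rw [smul_smul, mul_neg, mul_inv_cancel₀ (hw _).ne', neg_smul, one_smul, neg_neg, hG]

/-! ### The exponential and logistic losses -/

namespace LossKind

/-- The individual loss `ℓ = e^{-f}`. -/
noncomputable def ell (k : LossKind) (x : ℝ) : ℝ := Real.exp (-k.f x)

/-- The weight `w = -ℓ'`. -/
noncomputable def weight : LossKind → ℝ → ℝ
  | .exponential, x => Real.exp (-x)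
  | .logistic, x => Real.exp (-x) / (1 + Real.exp (-x))

/-- The inverse of `ℓ` on the positive reals. -/
noncomputable def ellInv : LossKind → ℝ → ℝ
  | .exponential, y => -Real.log y
  | .logistic, y => -Real.log (Real.exp y - 1)

theorem ell_exponential (x : ℝ) : ell .exponential x = Real.exp (-x) := rfl

theorem ell_logistic (x : ℝ) : ell .logistic x = Real.log (1 + Real.exp (-x)) := by
  have h : 0 < Real.log (1 + Real.exp (-x)) := Real.log_pos (by linarith [Real.exp_pos (-x)])
  simp only [ell, f, neg_neg, Real.exp_log h]

theorem ell_pos (k : LossKind) (x : ℝ) : 0 < k.ell x := Real.exp_pos _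

theorem weight_pos (k : LossKind) (x : ℝ) : 0 < k.weight x := by
  cases k <;> simp only [weight] <;> positivity

theorem finv_log_one_div (k : LossKind) {y : ℝ} (hy : 0 < y) :
    k.finv (Real.log (1 / y)) = k.ellInv y := by
  cases k
  · simp [finv, ellInv]
  · simp [finv, ellInv, Real.exp_log hy]

theorem ell_ellInv (k : LossKind) {y : ℝ} (hy : 0 < y) : k.ell (k.ellInv y) = y := by
  rw [← finv_log_one_div k hy, ell, f_finv, one_div, Real.log_inv, neg_neg, Real.exp_log hy]

theorem hasStrictDerivAt_ell (k : LossKind) (x : ℝ) :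
    HasStrictDerivAt k.ell (-k.weight x) x := by
  have h := (hasStrictDerivAt_id x).neg.exp
  cases k
  · have e : ell .exponential = fun x => Real.exp (-x) := funext ell_exponential
    rw [e]
    simpa [weight] using h
  · have e : ell .logistic = fun x => Real.log (1 + Real.exp (-x)) := funext ell_logistic
    rw [e]
    have := (h.const_add 1).log (by simp only [Pi.neg_apply, id]; positivity)
    simpa [weight, neg_div] using this

theorem ell_strictAnti (k : LossKind) : StrictAnti k.ell := by
  refine strictAnti_of_deriv_neg fun x => ?_
  rw [(k.hasStrictDerivAt_ell x).hasDerivAt.deriv]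
  exact neg_neg_of_pos (k.weight_pos x)

theorem hasStrictDerivAt_ellInv (k : LossKind) {y : ℝ} (hy : 0 < y) :
    HasStrictDerivAt k.ellInv (-(k.weight (k.ellInv y))⁻¹) y := by
  cases k
  · have e : ellInv .exponential = fun y => -Real.log y := rfl
    have := (Real.hasStrictDerivAt_log hy.ne').neg
    rw [e]
    simpa [weight, Real.exp_log hy] using! this
  · have h0 : 0 < Real.exp y - 1 := by
      have := Real.add_one_lt_exp hy.ne'
      linarith
    have e : ellInv .logistic = fun y => -Real.log (Real.exp y - 1) := rfl
    have h1 : HasStrictDerivAt (fun y => Real.exp y - 1) (Real.exp y) y :=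
      (Real.hasStrictDerivAt_exp y).sub_const 1
    have := (h1.log h0.ne').neg
    rw [e]
    simpa [weight, Real.exp_log h0] using! this

theorem ellInv_anti (k : LossKind) {x y : ℝ} (hx : 0 < x) (hxy : x ≤ y) :
    k.ellInv y ≤ k.ellInv x := by
  rw [← k.ell_strictAnti.le_iff_ge, k.ell_ellInv hx, k.ell_ellInv (hx.trans_le hxy)]
  exact hxy

theorem weight_anti (k : LossKind) : Antitone k.weight := by
  intro x y hxy
  have h : Real.exp (-y) ≤ Real.exp (-x) := Real.exp_le_exp.2 (neg_le_neg hxy)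
  cases k
  · exact h
  · simp only [weight]
    rw [div_le_div_iff₀ (by positivity) (by positivity)]
    linarith

/-- This says that `w / ℓ = f'` is nondecreasing. For the logistic loss with `u = e^{-x}`, its
reciprocal is the slope `(1 + u) log (1 + u) / u` of the convex function `t log t` from its zero at
`t = 1`. -/
theorem weight_mul_ell_le (k : LossKind) {x y : ℝ} (hxy : x ≤ y) :
    k.weight x * k.ell y ≤ k.weight y * k.ell x := by
  cases k
  · simp only [weight, ell_exponential]
    rw [mul_comm]
  · simp only [weight, ell_logistic]
    have h : Real.exp (-y) ≤ Real.exp (-x) := Real.exp_le_exp.2 (neg_le_neg hxy)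
    have hs := Real.exp_pos (-y)
    have hu := Real.exp_pos (-x)
    set s := Real.exp (-y)
    set u := Real.exp (-x)
    have hc := Real.convexOn_mul_log.2 (show (1 : ℝ) ∈ Ici (0 : ℝ) by simp)
      (show 1 + u ∈ Ici (0 : ℝ) from mem_Ici.2 (by linarith))
      (show 0 ≤ 1 - s / u from sub_nonneg.2 ((div_le_one hu).2 h))
      (show 0 ≤ s / u by positivity) (by ring)
    simp only [smul_eq_mul, Real.log_one, mul_zero, zero_add, mul_one] at hc
    have e : 1 - s / u + s / u * (1 + u) = 1 + s := by field_simp; ring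
    rw [e] at hc
    have hc' : u * ((1 + s) * Real.log (1 + s)) ≤ s * ((1 + u) * Real.log (1 + u)) := by
      calc u * ((1 + s) * Real.log (1 + s)) ≤ u * (s / u * ((1 + u) * Real.log (1 + u))) := by
            gcongr
        _ = s * ((1 + u) * Real.log (1 + u)) := by field_simp
    rw [div_mul_eq_mul_div, div_mul_eq_mul_div, div_le_div_iff₀ (by positivity) (by positivity)]
    linarith

/-- The factor 2 bounds the logistic denominator `1 + e^{-y}` for `y ≥ 0`. This estimate later
yields complementary slackness. -/
theorem weight_le_exp_mul (k : LossKind) (x : ℝ) {y : ℝ} (hy : 0 ≤ y) :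
    k.weight x ≤ 2 * Real.exp (y - x) * k.weight y := by
  have h1 : Real.exp (-x) = Real.exp (y - x) * Real.exp (-y) := by
    rw [← Real.exp_add]; ring_nf
  cases k
  · simp only [weight]
    rw [mul_assoc, ← h1]
    linarith [Real.exp_pos (-x)]
  · simp only [weight]
    have h2 : Real.exp (-y) ≤ 1 := Real.exp_le_one_iff.2 (by linarith)
    rw [mul_assoc, mul_div_assoc', ← h1, mul_div_assoc',
      div_le_div_iff₀ (by positivity) (by positivity)]
    nlinarith [Real.exp_pos (-x), Real.exp_pos (-y)]

theorem le_of_ell_sum_eq (k : LossKind) {N : ℕ} {a : Fin N → ℝ} {S : ℝ}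
    (h : ∑ i, k.ell (a i) = k.ell S) (i : Fin N) : S ≤ a i := by
  rw [← k.ell_strictAnti.le_iff_ge, ← h]
  exact Finset.single_le_sum (f := fun i => k.ell (a i)) (fun j _ => (k.ell_pos (a j)).le)
    (Finset.mem_univ i)

/-- Write `w = f' ℓ`. Since `S ≤ aᵢ`, both `f'(aᵢ) ≥ f'(S)` and `aᵢ ≥ S`; what remains is `∑ ℓ(aᵢ) =
ℓ(S)`. -/
theorem weight_mul_le_sum (k : LossKind) {N : ℕ} {a : Fin N → ℝ} {S : ℝ} (hS : 0 < S)
    (h : ∑ i, k.ell (a i) = k.ell S) : k.weight S * S ≤ ∑ i, k.weight (a i) * a i := by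
  have h1 : ∑ i, k.ell (a i) * (k.weight S * S / k.ell S) = k.weight S * S := by
    rw [← Finset.sum_mul, h]
    have := (k.ell_pos S).ne'
    field_simp
  rw [← h1]
  refine Finset.sum_le_sum fun i _ => ?_
  have hi := k.le_of_ell_sum_eq h i
  calc k.ell (a i) * (k.weight S * S / k.ell S)
      = k.weight S * k.ell (a i) * S / k.ell S := by ring
    _ ≤ k.weight (a i) * k.ell S * S / k.ell S := by
        have := k.weight_mul_ell_le hi
        have := k.ell_pos S
        gcongr ?_ * S / _
    _ = k.weight (a i) * S := by
        have := (k.ell_pos S).ne'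
        field_simp
    _ ≤ k.weight (a i) * a i := by
        have := k.weight_pos (a i)
        gcongr

end LossKind

theorem empLoss_pos {p N : ℕ} (hN : 0 < N) (k : LossKind) (q : Fin N → Param p → ℝ) (x : Param p) :
    0 < empLoss k q x :=
  have : Nonempty (Fin N) := ⟨⟨0, hN⟩⟩
  Finset.sum_pos (fun _ _ => Real.exp_pos _) Finset.univ_nonempty

theorem _root_.HasStrictDerivAt.exists_lipschitzOnWith_nhds {φ : ℝ → ℝ} {φ' x : ℝ}
    (h : HasStrictDerivAt φ φ' x) : ∃ K, ∃ s ∈ 𝓝 x, LipschitzOnWith K φ s :=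
  h.hasStrictFDerivAt.exists_lipschitzOnWith

theorem locallyLipschitz_empLoss {p N : ℕ} (k : LossKind) {q : Fin N → Param p → ℝ}
    (hq : ∀ i, LocallyLipschitz (q i)) : LocallyLipschitz (empLoss k q) := by
  have hterm : ∀ i, LocallyLipschitz fun x => k.ell (q i x) := fun i =>
    LocallyLipschitz.comp (f := k.ell)
      (fun a => (k.hasStrictDerivAt_ell a).exists_lipschitzOnWith_nhds) (hq i)
  have : ∀ s : Finset (Fin N), LocallyLipschitz fun x => ∑ i ∈ s, k.ell (q i x) := by
    intro s
    induction s using Finset.induction_on with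
    | empty => simpa using LocallyLipschitz.const 0
    | insert i s hi ih =>
      simp only [Finset.sum_insert hi]
      exact (hterm i).add ih
  exact this Finset.univ

/-! ### Absolutely continuous functions -/

theorem _root_.AbsolutelyContinuousOnInterval.lipschitz_comp {X Y : Type*} [SeminormedAddCommGroup X]
    [PseudoMetricSpace Y] {f : ℝ → X} {a b : ℝ} (hf : AbsolutelyContinuousOnInterval f a b)
    {F : X → Y} (hF : ∀ t ∈ uIcc a b, ∃ K, ∃ s ∈ 𝓝 (f t), LipschitzOnWith K F s) :
    AbsolutelyContinuousOnInterval (fun t => F (f t)) a b := by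
  have hloc : LocallyLipschitzOn (f '' uIcc a b) F := by
    rintro _ ⟨t, ht, rfl⟩
    obtain ⟨K, s, hs, hK⟩ := hF t ht
    exact ⟨K, s, mem_nhdsWithin_of_mem_nhds hs, hK⟩
  obtain ⟨K, hK⟩ := hloc.exists_lipschitzOnWith_of_compact
    (isCompact_uIcc.image_of_continuousOn hf.continuousOn)
  rw [absolutelyContinuousOnInterval_iff] at hf ⊢
  intro ε hε
  obtain ⟨δ, hδ, h⟩ := hf (ε / (K + 1)) (by positivity)
  refine ⟨δ, hδ, fun E hE hEδ => ?_⟩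
  have h1 : ∑ i ∈ Finset.range E.1, dist (F (f (E.2 i).1)) (F (f (E.2 i).2)) ≤
      K * ∑ i ∈ Finset.range E.1, dist (f (E.2 i).1) (f (E.2 i).2) := by
    rw [Finset.mul_sum]
    exact Finset.sum_le_sum fun i hi => hK.dist_le_mul _ ⟨_, (hE.1 i hi).1, rfl⟩ _
      ⟨_, (hE.1 i hi).2, rfl⟩
  have h2 := h E hE hEδ
  rw [lt_div_iff₀ (by positivity)] at h2
  have h3 : 0 ≤ ∑ i ∈ Finset.range E.1, dist (f (E.2 i).1) (f (E.2 i).2) :=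
    Finset.sum_nonneg fun i _ => dist_nonneg
  linarith

theorem _root_.AbsolutelyContinuousOnInterval.le_of_ae_deriv_nonneg {h : ℝ → ℝ} {a b : ℝ}
    (hab : a ≤ b) (hh : AbsolutelyContinuousOnInterval h a b)
    (hd : ∀ᵐ t ∂(volume.restrict (Icc a b)), ∃ h', 0 ≤ h' ∧ HasDerivAt h h' t) : h a ≤ h b := by
  rw [← sub_nonneg, ← hh.integral_deriv_eq_sub]
  refine intervalIntegral.integral_nonneg_of_ae_restrict hab ?_
  filter_upwards [hd] with t ⟨h', h0, ht⟩
  simpa [ht.deriv] using h0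

/-- Absolute continuity on all compact subintervals of `[T, ∞)`. -/
def ACFrom {X : Type*} [PseudoMetricSpace X] (f : ℝ → X) (T : ℝ) : Prop :=
  ∀ s, T ≤ s → AbsolutelyContinuousOnInterval f T s

namespace ACFrom

variable {X Y : Type*} [SeminormedAddCommGroup X] [PseudoMetricSpace Y] {T : ℝ}

theorem on {f : ℝ → X} (hf : ACFrom f T) {a b : ℝ} (ha : T ≤ a) (hab : a ≤ b) :
    AbsolutelyContinuousOnInterval f a b := by
  refine (hf b (ha.trans hab)).mono ?_
  rw [uIcc_of_le hab, uIcc_of_le (ha.trans hab)]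
  exact Icc_subset_Icc_left ha

theorem mono {f : ℝ → X} (hf : ACFrom f T) {T' : ℝ} (h : T ≤ T') : ACFrom f T' :=
  fun _ hs => hf.on h hs

theorem lipschitz_comp {f : ℝ → X} (hf : ACFrom f T) {F : X → Y}
    (hF : ∀ t, T ≤ t → ∃ K, ∃ s ∈ 𝓝 (f t), LipschitzOnWith K F s) :
    ACFrom (fun t => F (f t)) T := fun s hs => (hf s hs).lipschitz_comp fun t ht => by
  rw [uIcc_of_le hs] at ht
  exact hF t ht.1

theorem add {f g : ℝ → ℝ} (hf : ACFrom f T) (hg : ACFrom g T) : ACFrom (fun t => f t + g t) T :=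
  fun s hs => (hf s hs).add (hg s hs)

theorem sub {f g : ℝ → ℝ} (hf : ACFrom f T) (hg : ACFrom g T) : ACFrom (fun t => f t - g t) T :=
  fun s hs => (hf s hs).sub (hg s hs)

theorem mul {f g : ℝ → ℝ} (hf : ACFrom f T) (hg : ACFrom g T) : ACFrom (fun t => f t * g t) T :=
  fun s hs => (hf s hs).mul (hg s hs)

theorem const_mul {f : ℝ → ℝ} (hf : ACFrom f T) (c : ℝ) : ACFrom (fun t => c * f t) T :=
  fun s hs => (hf s hs).const_mul c

theorem neg {f : ℝ → ℝ} (hf : ACFrom f T) : ACFrom (fun t => -f t) T :=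
  fun s hs => (hf s hs).neg

theorem const (c : ℝ) : ACFrom (fun _ => c) T := fun _ _ =>
  (LipschitzWith.const c).lipschitzOnWith.absolutelyContinuousOnInterval

theorem id : ACFrom (fun t : ℝ => t) T := fun _ _ =>
  LipschitzWith.id.lipschitzOnWith.absolutelyContinuousOnInterval

theorem sum {ι : Type*} (s : Finset ι) {f : ι → ℝ → ℝ} (hf : ∀ i, ACFrom (f i) T) :
    ACFrom (fun t => ∑ i ∈ s, f i t) T := by
  classical
  induction s using Finset.induction_on with
  | empty =>
    simp only [Finset.sum_empty]
    exact ACFrom.const 0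
  | insert i s hi ih =>
    simp only [Finset.sum_insert hi]
    exact ACFrom.add (f := f i) (g := fun t => ∑ j ∈ s, f j t) (hf i) ih

theorem continuousOn {f : ℝ → X} (hf : ACFrom f T) {a b : ℝ} (ha : T ≤ a) (hab : a ≤ b) :
    ContinuousOn f (Icc a b) := by
  rw [← uIcc_of_le hab]
  exact (hf.on ha hab).continuousOn

theorem monotoneOn {h : ℝ → ℝ} (hh : ACFrom h T)
    (hd : ∀ᵐ t ∂(volume.restrict (Ici T)), ∃ h', 0 ≤ h' ∧ HasDerivAt h h' t) :
    MonotoneOn h (Ici T) := fun _ ha _ _ hab =>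
  (hh.on ha hab).le_of_ae_deriv_nonneg hab
    (ae_restrict_of_ae_restrict_of_subset (fun _ hx => le_trans ha hx.1) hd)

theorem ae_differentiableAt {f : ℝ → ℝ} (hf : ACFrom f T) :
    ∀ᵐ t ∂(volume.restrict (Ici T)), DifferentiableAt ℝ f t := by
  rw [ae_restrict_iff' measurableSet_Ici]
  have : ∀ n : ℕ, ∀ᵐ t, t ∈ uIcc T (T + n) → DifferentiableAt ℝ f t := fun n =>
    (hf _ (by simp)).ae_differentiableAt
  filter_upwards [ae_all_iff.2 this] with t ht htT
  obtain ⟨n, hn⟩ := exists_nat_ge (t - T)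
  exact ht n (by rw [uIcc_of_le (by simp)]; exact ⟨htT, by linarith⟩)

end ACFrom

theorem acFrom_integral {b : ℝ → ℝ} {T : ℝ} (hb : IntegrableOn b (Ici T)) :
    ACFrom (fun t => ∫ s in T..t, b s) T := fun s hs => by
  refine IntervalIntegrable.absolutelyContinuousOnInterval_intervalIntegral ?_ left_mem_uIcc
  rw [intervalIntegrable_iff_integrableOn_Icc_of_le hs]
  exact hb.mono_set Icc_subset_Ici_self

theorem ae_hasDerivAt_integral {b : ℝ → ℝ} {T : ℝ} (hb : IntegrableOn b (Ici T)) :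
    ∀ᵐ t ∂(volume.restrict (Ici T)), HasDerivAt (fun t => ∫ s in T..t, b s) (b t) t := by
  rw [ae_restrict_iff' measurableSet_Ici]
  have : ∀ n : ℕ, ∀ᵐ t, t ∈ uIcc T (T + n) → HasDerivAt (fun t => ∫ s in T..t, b s) (b t) t := by
    intro n
    have hn : IntervalIntegrable b volume T (T + n) := by
      rw [intervalIntegrable_iff_integrableOn_Icc_of_le (by simp)]
      exact hb.mono_set Icc_subset_Ici_self
    filter_upwards [hn.ae_hasDerivAt_integral] with t ht h
    exact ht h T left_mem_uIcc
  filter_upwards [ae_all_iff.2 this] with t ht htT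
  obtain ⟨n, hn⟩ := exists_nat_ge (t - T)
  exact ht n (by rw [uIcc_of_le (by simp)]; exact ⟨htT, by linarith⟩)

/-! ### Homogeneous functions -/

section Homogeneous

variable {p N : ℕ}

/-- Euler's identity. The chain rule along the ray `s ↦ s x` holds only at almost every `s`, but one
good `s` is enough: `ξ` is transported to `s x` by homogeneity. -/
theorem inner_clarkeSubdiff_eq {f : Param p → ℝ} (hf : LocallyLipschitz f)
    (hchain : AdmitsChainRule f) {L : ℝ}
    (hhom : ∀ α : ℝ, 0 < α → ∀ x, f (α • x) = α ^ L * f x) {x ξ : Param p}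
    (hξ : ξ ∈ clarkeSubdiff f x) : inner ℝ ξ x = L * f x := by
  have hlip : LipschitzWith ‖x‖₊ (fun s : ℝ => s • x) := LipschitzWith.of_dist_le_mul fun s t => by
    rw [dist_eq_norm, ← sub_smul, norm_smul, mul_comm, coe_nnnorm, dist_eq_norm]
  have h := hchain (fun s => s • x) 1 2 one_le_two
    hlip.lipschitzOnWith.absolutelyContinuousOnInterval
  have hne : (ae (volume.restrict (Icc (1 : ℝ) 2))).NeBot := by
    rw [ae_neBot, Ne, Measure.restrict_eq_zero]
    norm_num
  obtain ⟨t, ht, ht1⟩ := (h.and (ae_restrict_mem measurableSet_Icc)).exists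
  have ht0 : 0 < t := lt_of_lt_of_le one_pos ht1.1
  have h1 := ht _ (smul_mem_clarkeSubdiff_smul hf hhom ht0 hξ) x
    (by simpa using (hasDerivAt_id t).smul_const x)
  have h2 : HasDerivAt (fun s : ℝ => f (s • x)) (L * t ^ (L - 1) * f x) t := by
    refine ((Real.hasDerivAt_rpow_const (Or.inl ht0.ne')).mul_const (f x)).congr_of_eventuallyEq ?_
    filter_upwards [lt_mem_nhds ht0] with s hs using hhom s hs x
  have h3 := h1.unique h2
  rw [real_inner_smul_left] at h3
  have h4 : 0 < t ^ (L - 1) := Real.rpow_pos_of_pos ht0 _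
  refine mul_left_cancel₀ h4.ne' ?_
  rw [h3]
  ring

theorem homogeneous_zero {f : Param p → ℝ} {L : ℝ} (hL : 0 < L)
    (hhom : ∀ α : ℝ, 0 < α → ∀ x, f (α • x) = α ^ L * f x) : f 0 = 0 := by
  have h := hhom 2 two_pos 0
  rw [smul_zero] at h
  have h2 : (1 : ℝ) < 2 ^ L := Real.one_lt_rpow one_lt_two hL
  have h3 : f 0 * ((2 : ℝ) ^ L - 1) = 0 := by linarith
  exact (mul_eq_zero.1 h3).resolve_right (by linarith)

theorem exists_homogeneous_le {f : Param p → ℝ} (hf : Continuous f) {L : ℝ} (hL : 0 < L)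
    (hhom : ∀ α : ℝ, 0 < α → ∀ x, f (α • x) = α ^ L * f x) :
    ∃ M : ℝ, 0 < M ∧ ∀ x, f x ≤ M * ‖x‖ ^ L := by
  obtain ⟨M, hM⟩ := (isCompact_sphere (0 : Param p) 1).exists_bound_of_continuousOn hf.continuousOn
  refine ⟨max M 1, by positivity, fun x => ?_⟩
  by_cases hx : x = 0
  · simp [hx, homogeneous_zero hL hhom, Real.zero_rpow hL.ne']
  have hn : 0 < ‖x‖ := norm_pos_iff.2 hx
  have h1 := hhom ‖x‖ hn (‖x‖⁻¹ • x)
  rw [smul_smul, mul_inv_cancel₀ hn.ne', one_smul] at h1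
  have h2 := hM (‖x‖⁻¹ • x) (by simp [norm_smul, hn.ne'])
  rw [h1, mul_comm]
  have := (le_abs_self _).trans (h2.trans (le_max_left M 1))
  gcongr

theorem exists_norm_clarkeSubdiff_le_rpow {f : Param p → ℝ} (hf : LocallyLipschitz f) {L : ℝ}
    (hhom : ∀ α : ℝ, 0 < α → ∀ x, f (α • x) = α ^ L * f x) :
    ∃ K : ℝ, 0 ≤ K ∧ ∀ x ≠ 0, ∀ ξ ∈ clarkeSubdiff f x, ‖ξ‖ ≤ K * ‖x‖ ^ (L - 1) := by
  obtain ⟨K, hK0, hK⟩ : ∃ K : ℝ, 0 ≤ K ∧ ∀ y ∈ Metric.sphere (0 : Param p) 1,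
      ∀ ξ ∈ clarkeSubdiff f y, ‖ξ‖ ≤ K := by
    refine (isCompact_sphere (0 : Param p) 1).induction_on
      (p := fun s => ∃ K : ℝ, 0 ≤ K ∧ ∀ y ∈ s, ∀ ξ ∈ clarkeSubdiff f y, ‖ξ‖ ≤ K)
      ⟨0, le_rfl, by simp⟩ ?_ ?_ ?_
    · rintro s t hst ⟨K, h0, h⟩
      exact ⟨K, h0, fun y hy => h y (hst hy)⟩
    · rintro s t ⟨K, h0, h⟩ ⟨K', h0', h'⟩
      refine ⟨max K K', le_max_of_le_left h0, fun y hy ξ hξ => ?_⟩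
      rcases hy with hy | hy
      · exact (h y hy ξ hξ).trans (le_max_left _ _)
      · exact (h' y hy ξ hξ).trans (le_max_right _ _)
    · intro x _
      obtain ⟨K, h0, h⟩ := exists_norm_clarkeSubdiff_le hf x
      exact ⟨_, mem_nhdsWithin_of_mem_nhds h, K, h0, fun y hy => hy⟩
  refine ⟨K, hK0, fun x hx ξ hξ => ?_⟩
  have hn : 0 < ‖x‖ := norm_pos_iff.2 hx
  have hin : 0 < ‖x‖⁻¹ := inv_pos.2 hn
  have h := hK (‖x‖⁻¹ • x) (by simp [norm_smul, hn.ne']) _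
    (smul_mem_clarkeSubdiff_smul hf hhom hin hξ)
  rw [norm_smul, Real.norm_of_nonneg (Real.rpow_nonneg hin.le _), Real.inv_rpow hn.le,
    inv_mul_le_iff₀ (Real.rpow_pos_of_pos hn _)] at h
  linarith

end Homogeneous

/-! ### Subgradients of the empirical loss of a homogeneous model -/

section EmpLoss

variable {p N : ℕ} {k : LossKind} {q : Fin N → Param p → ℝ} {L : ℝ}

theorem exists_clarkeSubdiff_empLoss (hN : 0 < N) (hq : ∀ i, LocallyLipschitz (q i))
    {x ξ : Param p} (hξ : ξ ∈ clarkeSubdiff (empLoss k q) x) :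
    ∃ h : Fin N → Param p, (∀ i, h i ∈ clarkeSubdiff (q i) x) ∧
      ξ = -∑ i, k.weight (q i x) • h i :=
  exists_clarkeSubdiff_sum_comp hq k.hasStrictDerivAt_ell k.weight_pos
    (locallyLipschitz_empLoss k hq) hN hξ

theorem inner_clarkeSubdiff_empLoss (hN : 0 < N) (hq : ∀ i, LocallyLipschitz (q i))
    (hchain : ∀ i, AdmitsChainRule (q i))
    (hhom : ∀ α : ℝ, 0 < α → ∀ i w, q i (α • w) = α ^ L * q i w)
    {x ξ : Param p} (hξ : ξ ∈ clarkeSubdiff (empLoss k q) x) :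
    inner ℝ ξ x = -(L * ∑ i, k.weight (q i x) * q i x) := by
  obtain ⟨h, hh, rfl⟩ := exists_clarkeSubdiff_empLoss hN hq hξ
  rw [inner_neg_left, sum_inner, Finset.mul_sum]
  congr 1
  refine Finset.sum_congr rfl fun i _ => ?_
  rw [real_inner_smul_left, inner_clarkeSubdiff_eq (hq i) (hchain i) (fun α hα => hhom α hα i)
    (hh i)]
  ring

/-- Each term of `ξ` has size at most a constant times `w(qᵢ) ‖x‖^(L-1)`, and the margin bound turns
`‖x‖^L` into `qᵢ`, whose weighted sum is the radial part of `ξ` by Euler. Thus the radial part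
controls all of `ξ`. -/
theorem exists_norm_clarkeSubdiff_empLoss_le (hN : 0 < N) (hq : ∀ i, LocallyLipschitz (q i))
    (hchain : ∀ i, AdmitsChainRule (q i)) (hL : 0 < L)
    (hhom : ∀ α : ℝ, 0 < α → ∀ i w, q i (α • w) = α ^ L * q i w) {c : ℝ} (hc : 0 < c) :
    ∃ C : ℝ, 0 ≤ C ∧ ∀ x ≠ 0, (∀ i, c * ‖x‖ ^ L ≤ q i x) → ∀ ξ ∈ clarkeSubdiff (empLoss k q) x,
      ‖ξ‖ * ‖x‖ ≤ C * (-inner ℝ ξ x) := by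
  choose K hK0 hK using fun i => exists_norm_clarkeSubdiff_le_rpow (hq i)
    (fun α hα => hhom α hα i)
  refine ⟨(∑ i, K i) / (c * L), div_nonneg (Finset.sum_nonneg fun i _ => hK0 i) (by positivity),
    fun x hx hqx ξ hξ => ?_⟩
  rw [inner_clarkeSubdiff_empLoss hN hq hchain hhom hξ]
  obtain ⟨h, hh, rfl⟩ := exists_clarkeSubdiff_empLoss hN hq hξ
  have hn : 0 < ‖x‖ := norm_pos_iff.2 hx
  have hpow : ‖x‖ ^ (L - 1) * ‖x‖ = ‖x‖ ^ L := by
    rw [← Real.rpow_add_one hn.ne', sub_add_cancel]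
  rw [norm_neg]
  calc ‖∑ i, k.weight (q i x) • h i‖ * ‖x‖
      ≤ (∑ i, k.weight (q i x) * (K i * ‖x‖ ^ (L - 1))) * ‖x‖ := by
        refine mul_le_mul_of_nonneg_right ((norm_sum_le _ _).trans
          (Finset.sum_le_sum fun i _ => ?_)) hn.le
        have := k.weight_pos (q i x)
        rw [norm_smul, Real.norm_of_nonneg this.le]
        exact mul_le_mul_of_nonneg_left (hK i x hx _ (hh i)) this.le
    _ = ∑ i, k.weight (q i x) * K i * ‖x‖ ^ L := by
        rw [Finset.sum_mul]
        refine Finset.sum_congr rfl fun i _ => ?_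
        rw [← hpow]
        ring
    _ ≤ ∑ i, k.weight (q i x) * (∑ j, K j) * (q i x / c) := by
        refine Finset.sum_le_sum fun i _ => ?_
        have h1 : K i ≤ ∑ j, K j := Finset.single_le_sum (fun j _ => hK0 j) (Finset.mem_univ i)
        have h2 : ‖x‖ ^ L ≤ q i x / c := by
          rw [le_div_iff₀ hc]
          linarith [hqx i]
        have h3 := k.weight_pos (q i x)
        have h4 := (hK0 i).trans h1
        gcongr
    _ = (∑ i, K i) / (c * L) * - -(L * ∑ i, k.weight (q i x) * q i x) := by
        rw [neg_neg, Finset.mul_sum, Finset.mul_sum]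
        refine Finset.sum_congr rfl fun i _ => ?_
        field_simp

end EmpLoss

/-! ### KKT points from asymptotically aligned subgradients -/

section KKT

variable {p N : ℕ} {k : LossKind} {q : Fin N → Param p → ℝ} {L : ℝ}

theorem isMaxMarginKKTPoint_of_smul_sum (hq : ∀ i, LocallyLipschitz (q i))
    (hL : 0 < L) (hhom : ∀ α : ℝ, 0 < α → ∀ i w, q i (α • w) = α ^ L * q i w)
    {x : Param p} {μ : Fin N → ℝ} {h : Fin N → Param p} (j : Fin N)
    (hj : ∀ i, q j x ≤ q i x) (hpos : 0 < q j x) (hμ : ∀ i, 0 ≤ μ i)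
    (hh : ∀ i, h i ∈ clarkeSubdiff (q i) x) (hx : ∑ i, μ i • h i = x)
    (hcomp : ∀ i, q j x < q i x → μ i = 0) :
    ∃ c : ℝ, 0 < c ∧ IsMaxMarginKKTPoint q (c • x) := by
  -- Scaling that brings the smallest margin to exactly 1.
  set c : ℝ := (q j x) ^ (-L⁻¹) with hc
  have hc0 : 0 < c := Real.rpow_pos_of_pos hpos _
  have hcL : c ^ L * q j x = 1 := by
    rw [hc, ← Real.rpow_mul hpos.le, neg_mul, inv_mul_cancel₀ hL.ne', Real.rpow_neg_one,
      inv_mul_cancel₀ hpos.ne']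
  have hcLpos : 0 < c ^ L := Real.rpow_pos_of_pos hc0 _
  -- The point scales by `c` and subgradients by `c ^ (L - 1)`; the multipliers absorb the ratio.
  refine ⟨c, hc0, fun i => ?_, fun i => c ^ (1 - (L - 1)) * μ i, c • x,
    fun i => -(c ^ (L - 1) • h i), fun i => mul_nonneg (Real.rpow_nonneg hc0.le _) (hμ i),
    self_mem_clarkeSubdiff_half_norm_sq _,
    fun i => neg_mem_clarkeSubdiff_const_sub (hq i) 1
      (smul_mem_clarkeSubdiff_smul (hq i) (fun α hα => hhom α hα i) hc0 (hh i)), ?_, fun i => ?_⟩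
  · simp only [hhom c hc0]
    nlinarith [hj i]
  · have : ∀ i, (c ^ (1 - (L - 1)) * μ i) • -(c ^ (L - 1) • h i) = -(c • (μ i • h i)) := by
      intro i
      rw [smul_neg, smul_smul, smul_smul, mul_right_comm, ← Real.rpow_add hc0, sub_add_cancel,
        Real.rpow_one]
    simp only [this, Finset.sum_neg_distrib, ← Finset.smul_sum, hx, add_neg_cancel]
  · rcases (hj i).lt_or_eq with hlt | heq
    · simp [hcomp i hlt]
    · simp only [hhom c hc0, ← heq, hcL, sub_self, mul_zero]

/-- If `x_m / r_m → v̄`, `r_m → ∞`, the margins are bounded below and the subgradients of the loss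
at `x_m` are asymptotically aligned with `v̄`, then `v̄` is along the direction of a KKT point. -/
theorem exists_isMaxMarginKKTPoint_of_tendsto (hN : 0 < N) (hq : ∀ i, LocallyLipschitz (q i))
    (hchain : ∀ i, AdmitsChainRule (q i)) (hL : 0 < L)
    (hhom : ∀ α : ℝ, 0 < α → ∀ i w, q i (α • w) = α ^ L * q i w) {c : ℝ} (hc : 0 < c)
    {vbar : Param p} {x ξ : ℕ → Param p} {r : ℕ → ℝ} (hr : ∀ m, 0 < r m)
    (hrt : Tendsto r atTop atTop) (hx : Tendsto (fun m => (r m)⁻¹ • x m) atTop (𝓝 vbar))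
    (hqx : ∀ m i, c * r m ^ L ≤ q i (x m)) (hξ : ∀ m, ξ m ∈ clarkeSubdiff (empLoss k q) (x m))
    (hal : Tendsto (fun m => (r m / inner ℝ (ξ m) (x m)) • ξ m) atTop (𝓝 vbar)) :
    ∃ a : ℝ, 0 < a ∧ IsMaxMarginKKTPoint q (a • vbar) := by
  choose h hh hξh using fun m => exists_clarkeSubdiff_empLoss hN hq (hξ m)
  set u : ℕ → Param p := fun m => (r m)⁻¹ • x m with hu
  have hrL : ∀ m, 0 < r m ^ L := fun m => Real.rpow_pos_of_pos (hr m) _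
  have hqu : ∀ m i, q i (x m) = r m ^ L * q i (u m) := by
    intro m i
    rw [← hhom _ (hr m), hu, smul_smul, mul_inv_cancel₀ (hr m).ne', one_smul]
  have hquc : ∀ i, Tendsto (fun m => q i (u m)) atTop (𝓝 (q i vbar)) := fun i =>
    ((hq i).continuous.tendsto vbar).comp hx
  have hqv : ∀ i, c ≤ q i vbar := fun i => ge_of_tendsto' (hquc i) fun m => by
    have := hqx m i
    rw [hqu, mul_comm] at this
    exact le_of_mul_le_mul_left this (hrL m)
  set w : ℕ → Fin N → ℝ := fun m i => k.weight (q i (x m)) with hw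
  have hwpos : ∀ m i, 0 < w m i := fun m i => k.weight_pos _
  have hqpos : ∀ m i, 0 < q i (x m) := fun m i => (mul_pos hc (hrL m)).trans_le (hqx m i)
  set n : ℕ → ℝ := fun m => L * ∑ i, w m i * q i (x m) with hn
  have hinner : ∀ m, inner ℝ (ξ m) (x m) = -n m := fun m =>
    inner_clarkeSubdiff_empLoss hN hq hchain hhom (hξ m)
  have hnw : ∀ m i, L * (w m i * (c * r m ^ L)) ≤ n m := fun m i => by
    refine mul_le_mul_of_nonneg_left ?_ hL.le
    refine (mul_le_mul_of_nonneg_left (hqx m i) (hwpos m i).le).trans ?_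
    exact Finset.single_le_sum (f := fun i => w m i * q i (x m))
      (fun j _ => (mul_pos (hwpos m j) (hqpos m j)).le) (Finset.mem_univ i)
  have hnpos : ∀ m, 0 < n m := fun m =>
    (mul_pos hL (mul_pos (hwpos m ⟨0, hN⟩) (mul_pos hc (hrL m)))).trans_le (hnw m ⟨0, hN⟩)
  -- Approximate multipliers. Every margin is at least `c r^L`, so dividing by `n = L ∑ w qᵢ` keeps
  -- them below `(L c)⁻¹`.
  set μ : ℕ → Fin N → ℝ := fun m i => w m i * r m ^ L / n m with hμ
  have hμ0 : ∀ m i, 0 ≤ μ m i := fun m i =>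
    (div_pos (mul_pos (hwpos m i) (hrL m)) (hnpos m)).le
  have hμle : ∀ m i, μ m i ≤ (L * c)⁻¹ := fun m i => by
    rw [hμ, div_le_iff₀ (hnpos m), ← div_eq_inv_mul, le_div_iff₀ (by positivity)]
    linarith [hnw m i]
  set H : ℕ → Fin N → Param p := fun m i => (r m)⁻¹ ^ (L - 1) • h m i with hH
  have hHmem : ∀ m i, H m i ∈ clarkeSubdiff (q i) (u m) := fun m i =>
    smul_mem_clarkeSubdiff_smul (hq i) (fun α hα => hhom α hα i) (inv_pos.2 (hr m)) (hh m i)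
  have hsum : ∀ m, (r m / inner ℝ (ξ m) (x m)) • ξ m = ∑ i, μ m i • H m i := by
    intro m
    rw [hinner, hξh, div_neg, neg_smul, smul_neg, neg_neg, Finset.smul_sum]
    refine Finset.sum_congr rfl fun i _ => ?_
    simp only [hH, hμ, smul_smul]
    congr 1
    have e : r m ^ L = r m ^ (L - 1) * r m := by
      rw [← Real.rpow_add_one (hr m).ne', sub_add_cancel]
    have := (Real.rpow_pos_of_pos (hr m) (L - 1)).ne'
    simp only [Real.inv_rpow (hr m).le, hw]
    rw [e]
    field_simp
  choose K hK0 hK using fun i => exists_norm_clarkeSubdiff_le (hq i) vbar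
  have hHle : ∀ᶠ m in atTop, ∀ i, ‖H m i‖ ≤ K i := by
    refine eventually_all.2 fun i => ?_
    filter_upwards [hx.eventually (hK i)] with m hm using hm _ (hHmem m i)
  have hcpt : IsCompact ((univ.pi fun _ : Fin N => Icc (0 : ℝ) (L * c)⁻¹) ×ˢ
      (univ.pi fun i : Fin N => Metric.closedBall (0 : Param p) (K i))) :=
    (isCompact_univ_pi fun _ => isCompact_Icc).prod
      (isCompact_univ_pi fun i => isCompact_closedBall _ _)
  obtain ⟨⟨μ', h'⟩, -, φ, hφ, hlim⟩ := hcpt.tendsto_subseq' (x := fun m => (μ m, H m)) (by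
    refine (hHle.mono fun m hm => ⟨fun i _ => ⟨hμ0 m i, hμle m i⟩, fun i _ => ?_⟩).frequently
    simpa using hm i)
  have hφt := hφ.tendsto_atTop
  rw [nhds_prod_eq] at hlim
  have hμlim : ∀ i, Tendsto (fun m => μ (φ m) i) atTop (𝓝 (μ' i)) := fun i =>
    (tendsto_pi_nhds.1 (tendsto_fst.comp hlim)) i
  have hHlim : ∀ i, Tendsto (fun m => H (φ m) i) atTop (𝓝 (h' i)) := fun i =>
    (tendsto_pi_nhds.1 (tendsto_snd.comp hlim)) i
  obtain ⟨j, -, hj⟩ := Finset.exists_min_image Finset.univ (fun i => q i vbar)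
    ⟨⟨0, hN⟩, Finset.mem_univ _⟩
  refine isMaxMarginKKTPoint_of_smul_sum hq hL hhom (μ := μ') (h := h') j
    (fun i => hj i (Finset.mem_univ i)) (hc.trans_le (hqv j))
    (fun i => ge_of_tendsto' (hμlim i) fun m => hμ0 _ i)
    (fun i => mem_clarkeSubdiff_of_tendsto (hq i) (hx.comp hφt) (hHlim i)
      (Eventually.of_forall fun m => hHmem _ i)) ?_ ?_
  · refine tendsto_nhds_unique
      (tendsto_finsetSum Finset.univ fun i _ => (hμlim i).smul (hHlim i)) ?_
    exact (hal.comp hφt).congr fun m => hsum (φ m)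
  · intro i hi
    set δ := (q i vbar - q j vbar) / 2 with hδ
    have hδ0 : 0 < δ := by rw [hδ]; linarith
    have hgap : ∀ᶠ m in atTop, δ ≤ q i (u m) - q j (u m) := by
      have := ((hquc i).sub (hquc j)).eventually (lt_mem_nhds (show δ < q i vbar - q j vbar by
        rw [hδ]; linarith))
      exact this.mono fun m hm => hm.le
    -- A margin gap `δ` at the normalized point becomes `δ r^L` at `x m`, making the weight of a
    -- slack constraint exponentially small relative to that of `j`.
    have hexp : Tendsto (fun m => (L * c)⁻¹ * (2 * Real.exp (-(δ * r m ^ L)))) atTop (𝓝 0) := by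
      have h1 : Tendsto (fun m => δ * r m ^ L) atTop atTop :=
        ((tendsto_rpow_atTop hL).comp hrt).const_mul_atTop hδ0
      simpa using ((Real.tendsto_exp_neg_atTop_nhds_zero.comp h1).const_mul 2).const_mul (L * c)⁻¹
    have h0 : Tendsto (fun m => μ m i) atTop (𝓝 0) := by
      refine squeeze_zero' (Eventually.of_forall fun m => hμ0 m i) ?_ hexp
      filter_upwards [hgap] with m hm
      have h1 : w m i ≤ 2 * Real.exp (q j (x m) - q i (x m)) * w m j :=
        k.weight_le_exp_mul _ (hqpos m j).le
      have h2 : q j (x m) - q i (x m) ≤ -(δ * r m ^ L) := by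
        rw [hqu, hqu]
        nlinarith [hrL m]
      calc μ m i = (w m i / w m j) * μ m j := by
            have := (hwpos m j).ne'
            simp only [hμ]
            field_simp
        _ ≤ (2 * Real.exp (-(δ * r m ^ L))) * (L * c)⁻¹ := by
            refine mul_le_mul ?_ (hμle m j) (hμ0 m j) (by positivity)
            rw [div_le_iff₀ (hwpos m j)]
            refine h1.trans ?_
            have := hwpos m j
            gcongr
        _ = _ := by ring
    exact tendsto_nhds_unique (hμlim i) (h0.comp hφt)

end KKT

/-! ### Dynamics of the surrogate margin -/

theorem _root_.MonotoneOn.exists_forall_sub_le {h : ℝ → ℝ} {T C : ℝ} (hm : MonotoneOn h (Ici T))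
    (hC : ∀ t, T ≤ t → h t ≤ C) {η : ℝ} (hη : 0 < η) :
    ∃ T₁, T ≤ T₁ ∧ ∀ s s', T₁ ≤ s → T ≤ s' → h s' - h s ≤ η := by
  have hbdd : BddAbove (h '' Ici T) := ⟨C, by rintro _ ⟨t, ht, rfl⟩; exact hC t ht⟩
  obtain ⟨_, ⟨T₁, hT₁, rfl⟩, hlt⟩ := exists_lt_of_lt_csSup
    (show (h '' Ici T).Nonempty from ⟨_, T, self_mem_Ici, rfl⟩)
    (show sSup (h '' Ici T) - η < sSup (h '' Ici T) by linarith)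
  refine ⟨T₁, hT₁, fun s s' hs hs' => ?_⟩
  have h1 := hm hT₁ (le_trans hT₁ hs : T ≤ s) hs
  have h2 := le_csSup hbdd ⟨s', hs', rfl⟩
  linarith

/-- The evolution of the scalar quantities attached to an adaptive gradient flow: `S = ℓ⁻¹(𝓛)`,
`R` the logarithm of the rescaled norm of the parameters, `A = -d𝓛/dt`, `n = -⟨v, ξ⟩`, and `B` a
bounded primitive of the error `b` caused by the variation of the learning rates. -/
structure MarginDynamics (k : LossKind) (L T M Bmax : ℝ) (S R B n A b : ℝ → ℝ) : Prop where
  L_pos : 0 < L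
  M_pos : 0 < M
  acS : ACFrom S T
  acR : ACFrom R T
  acB : ACFrom B T
  S_pos : ∀ t, T ≤ t → 0 < S t
  S_le : ∀ t, T ≤ t → S t ≤ M * Real.exp (L * R t)
  B_nonneg : ∀ t, T ≤ t → 0 ≤ B t
  B_le : ∀ t, T ≤ t → B t ≤ Bmax
  hasDerivAt_S : ∀ᵐ t ∂(volume.restrict (Ici T)), HasDerivAt S (A t / k.weight (S t)) t
  hasDerivAt_B : ∀ᵐ t ∂(volume.restrict (Ici T)), 0 ≤ b t ∧ HasDerivAt B (b t) t
  hasDerivAt_R : ∀ᵐ t ∂(volume.restrict (Ici T)),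
    ∃ e, |e| ≤ b t / 2 ∧ HasDerivAt R (n t * Real.exp (-(2 * R t)) + e) t
  le_n : ∀ᵐ t ∂(volume.restrict (Ici T)), L * (k.weight (S t) * S t) ≤ n t
  n_sq_le : ∀ᵐ t ∂(volume.restrict (Ici T)), n t ^ 2 * Real.exp (-(2 * R t)) ≤ A t

namespace MarginDynamics

variable {k : LossKind} {L T M Bmax : ℝ} {S R B n A b : ℝ → ℝ}

theorem ae_n_pos (h : MarginDynamics k L T M Bmax S R B n A b) :
    ∀ᵐ t ∂(volume.restrict (Ici T)), 0 < n t := by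
  filter_upwards [h.le_n, ae_restrict_mem measurableSet_Ici] with t ht htT
  exact (mul_pos h.L_pos (mul_pos (k.weight_pos _) (h.S_pos t htT))).trans_le ht

theorem monotoneOn_B (h : MarginDynamics k L T M Bmax S R B n A b) : MonotoneOn B (Ici T) :=
  h.acB.monotoneOn (h.hasDerivAt_B.mono fun _ ht => ⟨_, ht.1, ht.2⟩)

theorem monotoneOn_S (h : MarginDynamics k L T M Bmax S R B n A b) : MonotoneOn S (Ici T) := by
  refine h.acS.monotoneOn ?_
  filter_upwards [h.hasDerivAt_S, h.n_sq_le] with t h1 h2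
  exact ⟨_, div_nonneg ((by positivity : (0 : ℝ) ≤ _).trans h2) (k.weight_pos _).le, h1⟩

theorem acLogS (h : MarginDynamics k L T M Bmax S R B n A b) :
    ACFrom (fun t => Real.log (S t)) T :=
  h.acS.lipschitz_comp fun t ht =>
    (Real.hasStrictDerivAt_log (h.S_pos t ht).ne').exists_lipschitzOnWith_nhds

theorem acPotential (h : MarginDynamics k L T M Bmax S R B n A b) :
    ACFrom (fun t => Real.log (S t) - L * R t + L / 2 * B t) T :=
  (h.acLogS.sub (h.acR.const_mul L)).add (h.acB.const_mul (L / 2))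

/-- The growth rate dominates the Cauchy–Schwarz defect: `L w(S) S ≤ n` bounds `(log S)'` below by
`L A / n`, and the term `L / 2 * B` pays for the error in `R'`. -/
theorem hasDerivAt_potential (h : MarginDynamics k L T M Bmax S R B n A b) :
    ∀ᵐ t ∂(volume.restrict (Ici T)), ∃ d,
      HasDerivAt (fun t => Real.log (S t) - L * R t + L / 2 * B t) d t ∧
      L * (A t / n t - n t * Real.exp (-(2 * R t))) ≤ d := by
  filter_upwards [h.hasDerivAt_S, h.hasDerivAt_B, h.hasDerivAt_R, h.le_n, h.n_sq_le, h.ae_n_pos,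
    ae_restrict_mem measurableSet_Ici] with t hS hB ⟨e, he, hR⟩ hn hnA hn0 htT
  have hSpos := h.S_pos t htT
  refine ⟨_, ((hS.log hSpos.ne').sub (hR.const_mul L)).add (hB.2.const_mul (L / 2)), ?_⟩
  have hA : 0 ≤ A t := (by positivity : (0 : ℝ) ≤ _).trans hnA
  have hw := k.weight_pos (S t)
  have h1 : L * (A t / n t) ≤ A t / k.weight (S t) / S t := by
    rw [div_div, mul_div_assoc', div_le_div_iff₀ hn0 (mul_pos hw hSpos)]
    nlinarith [mul_le_mul_of_nonneg_left hn hA]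
  have h2 := mul_le_mul_of_nonneg_left (abs_le.1 he).2 h.L_pos.le
  linarith

theorem potential_nonneg (h : MarginDynamics k L T M Bmax S R B n A b) :
    ∀ᵐ t ∂(volume.restrict (Ici T)), 0 ≤ A t / n t - n t * Real.exp (-(2 * R t)) := by
  filter_upwards [h.n_sq_le, h.ae_n_pos] with t h1 h2
  rw [sub_nonneg, le_div_iff₀ h2]
  linarith

theorem monotoneOn_potential (h : MarginDynamics k L T M Bmax S R B n A b) :
    MonotoneOn (fun t => Real.log (S t) - L * R t + L / 2 * B t) (Ici T) := by
  refine h.acPotential.monotoneOn ?_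
  filter_upwards [h.hasDerivAt_potential, h.potential_nonneg] with t ⟨d, hd, hle⟩ h0
  exact ⟨d, (mul_nonneg h.L_pos.le h0).trans hle, hd⟩

theorem potential_le (h : MarginDynamics k L T M Bmax S R B n A b) {t : ℝ} (ht : T ≤ t) :
    Real.log (S t) - L * R t + L / 2 * B t ≤ Real.log M + L / 2 * Bmax := by
  have h1 := Real.log_le_log (h.S_pos t ht) (h.S_le t ht)
  rw [Real.log_mul h.M_pos.ne' (Real.exp_pos _).ne', Real.log_exp] at h1
  have h2 := mul_le_mul_of_nonneg_left (h.B_le t ht) (half_pos h.L_pos).le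
  linarith

/-- The surrogate margin stays bounded away from zero. -/
theorem exists_margin_le (h : MarginDynamics k L T M Bmax S R B n A b) :
    ∃ c : ℝ, 0 < c ∧ ∀ t, T ≤ t → c * Real.exp (L * R t) ≤ S t := by
  refine ⟨Real.exp (Real.log (S T) - L * R T + L / 2 * B T - L / 2 * Bmax), Real.exp_pos _,
    fun t ht => ?_⟩
  rw [← Real.exp_add, ← Real.le_log_iff_exp_le (h.S_pos t ht)]
  have h1 := h.monotoneOn_potential self_mem_Ici ht ht
  have h2 := mul_le_mul_of_nonneg_left (h.B_le t ht) (half_pos h.L_pos).le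
  simp only at h1
  linarith

/-- If `S` stayed below `a`, the margin bound would keep `R` below some `ρ`, and `S' ≥ n² e^{-2R} /
w(S)` would exceed a positive constant `κ`; linear growth passes `a` by time `T + a / κ`. -/
theorem exists_lt_S (h : MarginDynamics k L T M Bmax S R B n A b) (a : ℝ) :
    ∃ t, T ≤ t ∧ a < S t := by
  by_contra! hS
  obtain ⟨c, hc, hcS⟩ := h.exists_margin_le
  have hST := h.S_pos T le_rfl
  have ha : 0 < a := hST.trans_le (hS T le_rfl)
  set ρ := Real.log (a / c) / L with hρ
  have hR : ∀ t, T ≤ t → R t ≤ ρ := fun t ht => by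
    rw [hρ, le_div_iff₀ h.L_pos, Real.le_log_iff_exp_le (by positivity), le_div_iff₀ hc]
    have := (hcS t ht).trans (hS t ht)
    rwa [mul_comm, mul_comm L] at this
  set κ := L ^ 2 * k.weight a * S T ^ 2 * Real.exp (-(2 * ρ)) with hκ
  have hL := h.L_pos
  have hwa := k.weight_pos a
  have hκ0 : 0 < κ := by positivity
  have hmono : MonotoneOn (fun t => S t - κ * t) (Ici T) := by
    refine (h.acS.sub (ACFrom.id.const_mul κ)).monotoneOn ?_
    filter_upwards [h.hasDerivAt_S, h.le_n, h.n_sq_le, ae_restrict_mem measurableSet_Ici]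
      with t h1 h2 h3 htT
    refine ⟨_, ?_, h1.sub ((hasDerivAt_id t).const_mul κ)⟩
    rw [mul_one, sub_nonneg, le_div_iff₀ (k.weight_pos _)]
    refine le_trans ?_ h3
    have hw := k.weight_pos (S t)
    have hwle : k.weight a ≤ k.weight (S t) := k.weight_anti (hS t htT)
    have hSle : S T ≤ S t := h.monotoneOn_S self_mem_Ici htT htT
    have hexp : Real.exp (-(2 * ρ)) ≤ Real.exp (-(2 * R t)) :=
      Real.exp_le_exp.2 (by linarith [hR t htT])
    calc κ * k.weight (S t)
        ≤ L ^ 2 * k.weight (S t) * S t ^ 2 * Real.exp (-(2 * R t)) * k.weight (S t) := by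
          rw [hκ]; gcongr
      _ = (L * (k.weight (S t) * S t)) ^ 2 * Real.exp (-(2 * R t)) := by ring
      _ ≤ n t ^ 2 * Real.exp (-(2 * R t)) := by
          have := h.S_pos t htT
          gcongr
  have hle : T ≤ T + a / κ := by
    have : 0 < a / κ := by positivity
    linarith
  have h1 := hmono self_mem_Ici hle hle
  have h2 := hS _ hle
  have h3 : κ * (a / κ) = a := by field_simp
  simp only [mul_add] at h1
  linarith

theorem tendsto_R (h : MarginDynamics k L T M Bmax S R B n A b) : Tendsto R atTop atTop := by
  refine tendsto_atTop.2 fun a => ?_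
  obtain ⟨t₁, ht₁, hS⟩ := h.exists_lt_S (M * Real.exp (L * a))
  filter_upwards [eventually_ge_atTop t₁] with t ht
  have h1 := h.monotoneOn_S ht₁ (ht₁.trans ht : T ≤ t) ht
  have h2 := (hS.trans_le h1).trans_le (h.S_le t (ht₁.trans ht))
  have h3 := Real.exp_lt_exp.1 (lt_of_mul_lt_mul_left h2 h.M_pos.le)
  exact (lt_of_mul_lt_mul_left h3 h.L_pos.le).le

/-- A bounded-speed observable cannot move far while the clock `R + B / 2` advances little. -/
theorem abs_observable_sub_le (h : MarginDynamics k L T M Bmax S R B n A b) {u : ℝ → ℝ} (hu : ACFrom u T)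
    {C : ℝ} (hC : 0 ≤ C) (hu' : ∀ᵐ t ∂(volume.restrict (Ici T)), ∃ d,
      |d| ≤ C * (n t * Real.exp (-(2 * R t)) + b t) ∧ HasDerivAt u d t)
    {s t : ℝ} (hs : T ≤ s) (hst : s ≤ t) :
    |u t - u s| ≤ C * ((R t + B t / 2) - (R s + B s / 2)) + C * (B t - B s) := by
  have hac : ACFrom (fun t => C * (R t + 1 / 2 * B t) + C * B t) T :=
    ((h.acR.add (h.acB.const_mul (1 / 2))).const_mul C).add (h.acB.const_mul C)
  have key : ∀ᵐ t ∂(volume.restrict (Ici T)), ∃ d d',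
      HasDerivAt u d t ∧ HasDerivAt (fun t => C * (R t + 1 / 2 * B t) + C * B t) d' t ∧
      |d| ≤ d' := by
    filter_upwards [hu', h.hasDerivAt_B, h.hasDerivAt_R] with t ⟨d, hd, hdu⟩ hB ⟨e, he, hR⟩
    refine ⟨d, _, hdu, ((hR.add (hB.2.const_mul (1 / 2))).const_mul C).add (hB.2.const_mul C),
      hd.trans ?_⟩
    have := mul_nonneg hC (show 0 ≤ e + 1 / 2 * b t by linarith [(abs_le.1 he).1])
    linarith
  have h1 := (hac.sub hu).monotoneOn (by
    filter_upwards [key] with t ⟨d, d', h1, h2, h3⟩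
    exact ⟨_, sub_nonneg.2 ((le_abs_self d).trans h3), h2.sub h1⟩) hs (hs.trans hst : T ≤ t) hst
  have h2 := (hac.add hu).monotoneOn (by
    filter_upwards [key] with t ⟨d, d', h1, h2, h3⟩
    exact ⟨d' + d, by linarith [neg_abs_le d], h2.add h1⟩) hs (hs.trans hst : T ≤ t) hst
  simp only at h1 h2
  rw [abs_le]
  constructor <;> linarith

/-- Near every time there are times of almost perfect alignment, in the sense of `n`, `A`, at which
the observables `u j` have barely changed. -/
theorem exists_aligned (h : MarginDynamics k L T M Bmax S R B n A b) {ι : Type*}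
    {u : ι → ℝ → ℝ} (hu : ∀ j, ACFrom (u j) T) {C : ℝ} (hC : 0 ≤ C)
    (hu' : ∀ j, ∀ᵐ t ∂(volume.restrict (Ici T)), ∃ d,
      |d| ≤ C * (n t * Real.exp (-(2 * R t)) + b t) ∧ HasDerivAt (u j) d t)
    {y : ι → ℝ} (hy : ∀ δ > 0, ∃ᶠ s in atTop, ∀ j, |u j s - y j| ≤ δ)
    {P : ℝ → Prop} (hP : ∀ᵐ t ∂(volume.restrict (Ici T)), P t) {δ : ℝ} (hδ : 0 < δ) (T₁ : ℝ) :
    ∃ t, T₁ ≤ t ∧ T ≤ t ∧ P t ∧ (∀ j, |u j t - y j| ≤ δ) ∧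
      A t ≤ (1 + δ) * (n t ^ 2 * Real.exp (-(2 * R t))) := by
  -- `δ₁` is the clock advance of the window, small enough that the observables move by at most `δ /
  -- 2`. `η` bounds the late increments of the potential and of `B`, with `η (1 + L δ)` strictly
  -- below `L δ δ₁`.
  have hL := h.L_pos
  set δ₁ := δ / (4 * (C + 1)) with hδ₁
  have hδ₁0 : 0 < δ₁ := by positivity
  set η := L * δ * δ₁ / (2 * (1 + L * δ)) with hη
  have hη0 : 0 < η := by positivity
  have hηmul : η * (1 + L * δ) = L * δ * δ₁ / 2 := by rw [hη]; field_simp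
  have hηle : η ≤ δ₁ := by
    rw [hη, div_le_iff₀ (by positivity)]
    nlinarith [mul_pos (mul_pos hL hδ) hδ₁0]
  have hCδ : C * δ₁ ≤ δ / 4 := by
    rw [hδ₁, mul_div_assoc', div_le_div_iff₀ (by positivity) (by positivity)]
    nlinarith
  obtain ⟨T₂, hT₂, hΦ⟩ := h.monotoneOn_potential.exists_forall_sub_le
    (fun t ht => h.potential_le ht) hη0
  obtain ⟨T₃, hT₃, hB⟩ := h.monotoneOn_B.exists_forall_sub_le h.B_le hη0
  obtain ⟨s, hsy, hsT⟩ := ((hy (δ / 2) (half_pos hδ)).and_eventually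
    (eventually_ge_atTop (max T₁ (max T₂ T₃)))).exists
  simp only [max_le_iff] at hsT
  obtain ⟨hs1, hs2, hs3⟩ := hsT
  have hs : T ≤ s := hT₂.trans hs2
  have hacW : ACFrom (fun t => R t + 1 / 2 * B t) T := h.acR.add (h.acB.const_mul (1 / 2))
  obtain ⟨s', hss', hs'W⟩ : ∃ s', s ≤ s' ∧ R s' + 1 / 2 * B s' = R s + 1 / 2 * B s + δ₁ := by
    obtain ⟨t, ht1, ht2⟩ := ((h.tendsto_R.eventually_ge_atTop (R s + 1 / 2 * B s + δ₁)).and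
      (eventually_ge_atTop s)).exists
    obtain ⟨s', hs', hW⟩ := intermediate_value_Icc ht2 (hacW.continuousOn hs ht2)
      (show R s + 1 / 2 * B s + δ₁ ∈ Icc _ _ from
        ⟨by linarith, by linarith [h.B_nonneg t (hs.trans ht2)]⟩)
    exact ⟨s', hs'.1, hW⟩
  have hmonoW : MonotoneOn (fun t => R t + 1 / 2 * B t) (Ici T) := by
    refine hacW.monotoneOn ?_
    filter_upwards [h.hasDerivAt_B, h.hasDerivAt_R, h.ae_n_pos] with t hB ⟨e, he, hR⟩ hn
    refine ⟨_, ?_, hR.add (hB.2.const_mul (1 / 2))⟩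
    have := mul_pos hn (Real.exp_pos (-(2 * R t)))
    linarith [(abs_le.1 he).1]
  obtain ⟨t, ht, htP, htA⟩ : ∃ t, t ∈ Icc s s' ∧ P t ∧
      A t ≤ (1 + δ) * (n t ^ 2 * Real.exp (-(2 * R t))) := by
    -- If alignment failed wherever `P` holds in the window, the potential would gain at least `L δ
    -- (δ₁ - η)`, more than the allowed `η`.
    by_contra! hcon
    have hac := (h.acPotential.sub (hacW.const_mul (L * δ))).add (h.acB.const_mul (L * δ))
    have hsub : Icc s s' ⊆ Ici T := fun t ht => hs.trans ht.1
    have hle := (hac.on hs hss').le_of_ae_deriv_nonneg hss' (by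
      filter_upwards [ae_restrict_of_ae_restrict_of_subset hsub hP,
        ae_restrict_of_ae_restrict_of_subset hsub h.hasDerivAt_potential,
        ae_restrict_of_ae_restrict_of_subset hsub h.hasDerivAt_B,
        ae_restrict_of_ae_restrict_of_subset hsub h.hasDerivAt_R,
        ae_restrict_of_ae_restrict_of_subset hsub h.ae_n_pos,
        ae_restrict_mem measurableSet_Icc] with t hPt ⟨d, hd, hdle⟩ hBt ⟨e, he, hR⟩ hn htI
      refine ⟨_, ?_, (hd.sub ((hR.add (hBt.2.const_mul (1 / 2))).const_mul (L * δ))).add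
        (hBt.2.const_mul (L * δ))⟩
      have hgt := hcon t htI hPt
      have h1 : (1 + δ) * (n t * Real.exp (-(2 * R t))) ≤ A t / n t := by
        rw [le_div_iff₀ hn]
        linarith
      have h2 := mul_le_mul_of_nonneg_left h1 hL.le
      have h3 := mul_nonneg (mul_pos hL hδ).le
        (show 0 ≤ 1 / 2 * b t - e by linarith [(abs_le.1 he).2])
      linarith)
    have h1 := hΦ s s' hs2 (hs.trans hss')
    have h2 := hB s s' hs3 (hs.trans hss')
    have h3 := mul_le_mul_of_nonneg_left h2 (mul_pos hL hδ).le
    simp only [hs'W] at hle h1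
    nlinarith [mul_pos (mul_pos hL hδ) hδ₁0]
  have hTt : T ≤ t := hs.trans ht.1
  refine ⟨t, hs1.trans ht.1, hTt, htP, fun j => ?_, htA⟩
  have h1 := h.abs_observable_sub_le (hu j) hC (hu' j) hs ht.1
  have h2 := hmonoW hTt (hs.trans hss' : T ≤ s') ht.2
  have h3 := hB s t hs3 hTt
  have h4 : C * ((R t + B t / 2) - (R s + B s / 2)) ≤ C * δ₁ := by
    refine mul_le_mul_of_nonneg_left ?_ hC
    simp only at h2
    linarith
  have h5 : C * (B t - B s) ≤ C * δ₁ := mul_le_mul_of_nonneg_left (h3.trans hηle) hC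
  calc |u j t - y j| ≤ |u j t - u j s| + |u j s - y j| := abs_sub_le _ _ _
    _ ≤ δ := by linarith [hsy j]

end MarginDynamics

/-! ### Adaptive gradient flows of homogeneous models -/

section Flow

variable {p N : ℕ}

theorem tendsto_of_coordinates {α : Type*} {l : Filter α} {X : α → Param p} {x : Param p}
    (h : ∀ j, Tendsto (fun m => X m j) l (𝓝 (x j))) : Tendsto X l (𝓝 x) :=
  ((PiLp.continuous_toLp 2 fun _ : Fin p => ℝ).tendsto (WithLp.ofLp x)).comp (tendsto_pi_nhds.2 h)

theorem tendsto_coordinate {α : Type*} {l : Filter α} {X : α → Param p} {x : Param p}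
    (h : Tendsto X l (𝓝 x)) (j : Fin p) : Tendsto (fun m => X m j) l (𝓝 (x j)) :=
  ((EuclideanSpace.proj (𝕜 := ℝ) j).continuous.tendsto x).comp h

theorem inner_eq_sum (x y : Param p) : inner ℝ x y = ∑ j, x j * y j := by
  simp [PiLp.inner_apply, mul_comm]

theorem inner_neg_hadamard (b ξ : Param p) :
    inner ℝ ξ (-hadamard b ξ) = -∑ j, b j * ξ j ^ 2 := by
  rw [inner_neg_right, inner_eq_sum]
  congr 1
  refine Finset.sum_congr rfl fun j _ => ?_
  simp only [hadamard]
  ring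

theorem hasDerivAt_coordinate {v : ℝ → Param p} {v' : Param p} {t : ℝ} (h : HasDerivAt v v' t)
    (j : Fin p) : HasDerivAt (fun s => v s j) (v' j) t :=
  (EuclideanSpace.proj (𝕜 := ℝ) j).hasFDerivAt.comp_hasDerivAt t h

theorem ACFrom.coordinate {v : ℝ → Param p} {T : ℝ} (h : ACFrom v T) (j : Fin p) :
    ACFrom (fun s => v s j) T :=
  h.lipschitz_comp (F := fun x : Param p => x j) fun _ _ =>
    ⟨_, univ, univ_mem, (EuclideanSpace.proj (𝕜 := ℝ) j).lipschitz.lipschitzOnWith⟩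

theorem AdmitsChainRule.ae_Ici {f : Param p → ℝ} (hf : AdmitsChainRule f) {v : ℝ → Param p}
    {T : ℝ} (hv : ACFrom v T) :
    ∀ᵐ t ∂(volume.restrict (Ici T)), ∀ ξ ∈ clarkeSubdiff f (v t), ∀ z' : Param p,
      HasDerivAt v z' t → HasDerivAt (fun s => f (v s)) (inner ℝ ξ z') t := by
  rw [ae_restrict_iff' measurableSet_Ici]
  have h : ∀ n : ℕ, _ := fun n => (ae_restrict_iff' measurableSet_Icc).1
    (hf v T (T + n) (by simp) (hv _ (by simp)))
  filter_upwards [ae_all_iff.2 h] with t ht htT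
  obtain ⟨n, hn⟩ := exists_nat_ge (t - T)
  exact ht n ⟨htT, by linarith⟩

theorem hasDerivAt_empLoss_ae {k : LossKind} {q : Fin N → Param p → ℝ} (hN : 0 < N)
    (hq : ∀ i, LocallyLipschitz (q i)) (hchain : ∀ i, AdmitsChainRule (q i))
    {β v ξ : ℝ → Param p} {T : ℝ} (hv : ACFrom v T)
    (hξ : ∀ᵐ t ∂(volume.restrict (Ici T)), ξ t ∈ clarkeSubdiff (empLoss k q) (v t) ∧
      HasDerivAt v (-hadamard (β t) (ξ t)) t) :
    ∀ᵐ t ∂(volume.restrict (Ici T)),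
      HasDerivAt (fun s => empLoss k q (v s)) (-∑ j, β t j * ξ t j ^ 2) t := by
  filter_upwards [hξ, ae_all_iff.2 fun i => (hchain i).ae_Ici hv] with t ⟨hmem, hd⟩ hc
  obtain ⟨h, hh, hξh⟩ := exists_clarkeSubdiff_empLoss hN hq hmem
  have h1 : ∀ i, HasDerivAt (fun s => k.ell (q i (v s)))
      (-k.weight (q i (v t)) * inner ℝ (h i) (-hadamard (β t) (ξ t))) t := fun i =>
    (k.hasStrictDerivAt_ell _).hasDerivAt.comp t (hc i (h i) (hh i) _ hd)
  have h2 := HasDerivAt.fun_sum fun i (_ : i ∈ Finset.univ) => h1 i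
  rw [← inner_neg_hadamard]
  convert! h2 using 1
  conv_lhs => rw [hξh]
  rw [inner_neg_left, sum_inner, ← Finset.sum_neg_distrib]
  refine Finset.sum_congr rfl fun i _ => ?_
  rw [real_inner_smul_left, neg_mul, ← hξh]

/-- The squared norm of `β^{-1/2} ⊙ v`. -/
noncomputable def rescaledSq (β v : ℝ → Param p) (t : ℝ) : ℝ :=
  ∑ j, v t j ^ 2 * Real.exp (-Real.log (β t j))

/-- The logarithm of the norm of `β^{-1/2} ⊙ v`. -/
noncomputable def logRadius (β v : ℝ → Param p) (t : ℝ) : ℝ := Real.log (rescaledSq β v t) / 2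

/-- The total variation rate of `log β`. -/
noncomputable def rateVariation (β : ℝ → Param p) (t : ℝ) : ℝ :=
  ∑ j, |deriv (fun s => Real.log (β s j)) t|

theorem rateVariation_nonneg (β : ℝ → Param p) (t : ℝ) : 0 ≤ rateVariation β t :=
  Finset.sum_nonneg fun _ _ => abs_nonneg _

theorem exp_neg_two_mul_logRadius {β v : ℝ → Param p} {t : ℝ} (h : 0 < rescaledSq β v t) :
    Real.exp (-(2 * logRadius β v t)) = (rescaledSq β v t)⁻¹ := by
  rw [logRadius, mul_div_cancel₀ _ two_ne_zero, Real.exp_neg, Real.exp_log h]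

theorem exp_neg_log_rate {b : ℝ} (h : 0 < b) : Real.exp (-Real.log b) = b⁻¹ := by
  rw [Real.exp_neg, Real.exp_log h]

theorem rescaledSq_bounds {β v : ℝ → Param p} {t : ℝ} (hβ : ∀ j, 1 / 2 ≤ β t j ∧ β t j ≤ 2) :
    1 / 2 * ‖v t‖ ^ 2 ≤ rescaledSq β v t ∧ rescaledSq β v t ≤ 2 * ‖v t‖ ^ 2 := by
  rw [EuclideanSpace.real_norm_sq_eq, Finset.mul_sum, Finset.mul_sum]
  have hβ0 : ∀ j, 0 < β t j := fun j => lt_of_lt_of_le (by norm_num) (hβ j).1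
  have h1 : ∀ j, 1 / 2 ≤ (β t j)⁻¹ := fun j => by
    rw [one_div]; exact inv_anti₀ (hβ0 j) (hβ j).2
  have h2 : ∀ j, (β t j)⁻¹ ≤ 2 := fun j => by
    rw [inv_le_comm₀ (hβ0 j) two_pos, ← one_div]; exact (hβ j).1
  constructor <;> refine Finset.sum_le_sum fun j _ => ?_ <;> rw [exp_neg_log_rate (hβ0 j)]
  · nlinarith [mul_le_mul_of_nonneg_left (h1 j) (sq_nonneg (v t j))]
  · nlinarith [mul_le_mul_of_nonneg_left (h2 j) (sq_nonneg (v t j))]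

theorem norm_mul_exp_neg_logRadius_bounds {β v : ℝ → Param p} {t : ℝ} (hv : v t ≠ 0)
    (hβ : ∀ j, 1 / 2 ≤ β t j ∧ β t j ≤ 2) :
    1 / 2 ≤ ‖v t‖ * Real.exp (-logRadius β v t) ∧ ‖v t‖ * Real.exp (-logRadius β v t) ≤ 2 := by
  have hb := rescaledSq_bounds (v := v) hβ
  have hn : 0 < ‖v t‖ := norm_pos_iff.2 hv
  have hQ : 0 < rescaledSq β v t := lt_of_lt_of_le (by positivity) hb.1
  have hsq : (‖v t‖ * Real.exp (-logRadius β v t)) ^ 2 = ‖v t‖ ^ 2 / rescaledSq β v t := by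
    rw [mul_pow, ← Real.exp_nat_mul, div_eq_mul_inv, ← exp_neg_two_mul_logRadius hQ]
    push_cast
    ring_nf
  have h0 : 0 < ‖v t‖ * Real.exp (-logRadius β v t) := by positivity
  constructor
  · refine le_of_sq_le_sq ?_ h0.le
    rw [hsq, le_div_iff₀ hQ]
    nlinarith
  · refine le_of_sq_le_sq ?_ two_pos.le
    rw [hsq, div_le_iff₀ hQ]
    nlinarith

/-- Writing `β⁻¹` as `exp (-log β)` makes this follow from absolute continuity of `log β`, with no
positivity needed. -/
theorem acFrom_rescaledSq {β v : ℝ → Param p} {T : ℝ} (hv : ACFrom v T)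
    (hβ : ∀ j, ACFrom (fun t => Real.log (β t j)) T) : ACFrom (rescaledSq β v) T := by
  refine ACFrom.sum Finset.univ (f := fun j t => v t j ^ 2 * Real.exp (-Real.log (β t j)))
    fun j => ?_
  simp only [pow_two]
  exact ((hv.coordinate j).mul (hv.coordinate j)).mul ((hβ j).neg.lipschitz_comp fun t _ =>
    (Real.hasStrictDerivAt_exp _).exists_lipschitzOnWith_nhds)

theorem acFrom_logRadius {β v : ℝ → Param p} {T : ℝ} (hv : ACFrom v T)
    (hβ : ∀ j, ACFrom (fun t => Real.log (β t j)) T) (hQ : ∀ t, T ≤ t → 0 < rescaledSq β v t) :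
    ACFrom (logRadius β v) T := by
  have h1 : ACFrom (fun t => Real.log (rescaledSq β v t)) T :=
    (acFrom_rescaledSq hv hβ).lipschitz_comp fun t ht =>
      (Real.hasStrictDerivAt_log (hQ t ht).ne').exists_lipschitzOnWith_nhds
  have h2 := h1.const_mul (1 / 2)
  have h3 : logRadius β v = fun t => 1 / 2 * Real.log (rescaledSq β v t) := by
    funext t; rw [logRadius]; ring
  rwa [h3]

/-- Differentiating `vⱼ² / βⱼ` along the flow gives `-2 ξⱼ vⱼ`, free of `β`, minus `vⱼ² / βⱼ` times
`(log βⱼ)'`. After division by twice the sum, the latter is a weighted average, hence the bound on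
`e`. -/
theorem hasDerivAt_logRadius {β v : ℝ → Param p} {t : ℝ} {ξ : Param p}
    (hβ : ∀ j, 0 < β t j) (hQ : 0 < rescaledSq β v t)
    (hd : HasDerivAt v (-hadamard (β t) ξ) t)
    (hl : ∀ j, DifferentiableAt ℝ (fun s => Real.log (β s j)) t) :
    ∃ e, |e| ≤ rateVariation β t / 2 ∧
      HasDerivAt (logRadius β v) (-inner ℝ ξ (v t) * Real.exp (-(2 * logRadius β v t)) + e) t := by
  set l' : Fin p → ℝ := fun j => deriv (fun s => Real.log (β s j)) t with hl'
  set E : ℝ := ∑ j, v t j ^ 2 * Real.exp (-Real.log (β t j)) * l' j with hE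
  have hterm : ∀ j, HasDerivAt (fun s => v s j ^ 2 * Real.exp (-Real.log (β s j)))
      (2 * -(ξ j * v t j) - v t j ^ 2 * Real.exp (-Real.log (β t j)) * l' j) t := by
    intro j
    have h1 := ((hasDerivAt_coordinate hd j).pow 2).mul (hl j).hasDerivAt.neg.exp
    convert! h1 using 1
    simp only [hadamard, PiLp.neg_apply, Pi.neg_apply, Pi.pow_apply, exp_neg_log_rate (hβ j), hl']
    have := (hβ j).ne'
    field_simp
    push_cast
    ring
  have hQ' : HasDerivAt (rescaledSq β v) (2 * -inner ℝ ξ (v t) - E) t := by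
    have h1 := HasDerivAt.fun_sum fun j (_ : j ∈ Finset.univ) => hterm j
    rw [Finset.sum_sub_distrib, ← Finset.mul_sum, Finset.sum_neg_distrib, ← inner_eq_sum] at h1
    exact h1
  refine ⟨-(E / rescaledSq β v t) / 2, ?_, ?_⟩
  · rw [abs_div, abs_neg, abs_two, abs_div, abs_of_pos hQ]
    gcongr
    rw [div_le_iff₀ hQ, mul_comm, rescaledSq, Finset.sum_mul]
    refine (Finset.abs_sum_le_sum_abs _ _).trans (Finset.sum_le_sum fun j _ => ?_)
    rw [abs_mul, abs_of_nonneg (by positivity : 0 ≤ v t j ^ 2 * Real.exp (-Real.log (β t j)))]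
    refine mul_le_mul_of_nonneg_left ?_ (by positivity)
    exact Finset.single_le_sum (f := fun j => |l' j|) (fun i _ => abs_nonneg _)
      (Finset.mem_univ j)
  · have h1 := (hQ'.log hQ.ne').div_const 2
    rw [exp_neg_two_mul_logRadius hQ]
    convert! h1 using 1
    ring

/-- Cauchy–Schwarz for `β^{-1/2} ⊙ v` and `β^{1/2} ⊙ ξ`. -/
theorem sq_inner_le {β v : ℝ → Param p} {t : ℝ} (ξ : Param p) (hβ : ∀ j, 0 < β t j) :
    (-inner ℝ ξ (v t)) ^ 2 ≤ rescaledSq β v t * ∑ j, β t j * ξ j ^ 2 := by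
  rw [neg_sq, inner_eq_sum]
  refine Finset.sum_sq_le_sum_mul_sum_of_sq_le_mul _ (fun j _ => by positivity)
    (fun j _ => mul_nonneg (hβ j).le (sq_nonneg _)) fun j _ => ?_
  rw [exp_neg_log_rate (hβ j)]
  have := (hβ j).ne'
  refine le_of_eq ?_
  field_simp

/-- Stability of the equality case of Cauchy–Schwarz: the `β`-weighted sum of these squares expands
to `1 - 2 + A e^{2R} / n² ≤ δ`, and `β ≥ 1/2` costs the factor 2. -/
theorem coordinate_defect_sq_le {β v : ℝ → Param p} {t : ℝ} {ξ : Param p} {δ : ℝ}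
    (hβ : ∀ j, 1 / 2 ≤ β t j) (hQ : 0 < rescaledSq β v t) (hn : 0 < -inner ℝ ξ (v t))
    (hA : ∑ j, β t j * ξ j ^ 2 ≤
      (1 + δ) * ((-inner ℝ ξ (v t)) ^ 2 * Real.exp (-(2 * logRadius β v t)))) (j : Fin p) :
    ((β t j)⁻¹ * (v t j * Real.exp (-logRadius β v t)) -
      Real.exp (logRadius β v t) / inner ℝ ξ (v t) * ξ j) ^ 2 ≤ 2 * δ := by
  have hβ0 : ∀ j, 0 < β t j := fun j => lt_of_lt_of_le (by norm_num) (hβ j)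
  set E := Real.exp (-logRadius β v t) with hE
  have hE0 : 0 < E := Real.exp_pos _
  have hEE : Real.exp (logRadius β v t) = E⁻¹ := by rw [hE, Real.exp_neg, inv_inv]
  have hE2 : E ^ 2 = (rescaledSq β v t)⁻¹ := by
    rw [← exp_neg_two_mul_logRadius hQ, hE, ← Real.exp_nat_mul]
    push_cast
    ring_nf
  rw [exp_neg_two_mul_logRadius hQ, ← hE2] at hA
  set I := inner ℝ ξ (v t) with hI
  have hI0 : I ≠ 0 := (neg_pos.1 hn).ne
  have hsum : ∑ j, β t j * ((β t j)⁻¹ * (v t j * E) - E⁻¹ / I * ξ j) ^ 2 ≤ δ := by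
    have e : ∀ j, β t j * ((β t j)⁻¹ * (v t j * E) - E⁻¹ / I * ξ j) ^ 2 =
        v t j ^ 2 * Real.exp (-Real.log (β t j)) * E ^ 2 - 2 / I * (ξ j * v t j) +
          β t j * ξ j ^ 2 * (E ^ 2 * I ^ 2)⁻¹ := by
      intro j
      rw [exp_neg_log_rate (hβ0 j)]
      have := (hβ0 j).ne'
      field_simp
      ring
    simp only [e]
    rw [Finset.sum_add_distrib, Finset.sum_sub_distrib, ← Finset.sum_mul, ← Finset.mul_sum,
      ← Finset.sum_mul, ← inner_eq_sum, ← hI]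
    change rescaledSq β v t * E ^ 2 - 2 / I * I + _ ≤ δ
    rw [hE2, mul_inv_cancel₀ hQ.ne', div_mul_cancel₀ _ hI0, ← hE2]
    have h0 : 0 < E ^ 2 * I ^ 2 := by positivity
    have h1 : (∑ j, β t j * ξ j ^ 2) * (E ^ 2 * I ^ 2)⁻¹ ≤ 1 + δ := by
      rw [← div_eq_mul_inv, div_le_iff₀ h0]
      linarith
    linarith
  have hj := (Finset.single_le_sum
    (f := fun j => β t j * ((β t j)⁻¹ * (v t j * E) - E⁻¹ / I * ξ j) ^ 2)
    (fun i _ => mul_nonneg (hβ0 i).le (sq_nonneg _)) (Finset.mem_univ j)).trans hsum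
  rw [hEE]
  simp only at hj
  nlinarith [mul_le_mul_of_nonneg_right (hβ j)
    (sq_nonneg ((β t j)⁻¹ * (v t j * E) - E⁻¹ / I * ξ j))]

/-- Rescaling by `β^{-1/2}` does not change the limit points of the direction. -/
theorem frequently_rescaled_close {β v : ℝ → Param p}
    (hβ : ∀ j, Tendsto (fun t => β t j) atTop (𝓝 1)) (hβ0 : ∀ t, 0 ≤ t → ∀ j, 0 < β t j)
    (hv : ∀ᶠ t in atTop, v t ≠ 0) {vbar : Param p}
    (hlim : MapClusterPt vbar atTop (fun t : ℝ => ‖v t‖⁻¹ • v t)) {δ : ℝ} (hδ : 0 < δ) :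
    ∃ᶠ s in atTop, ∀ j, |v s j * Real.exp (-logRadius β v s) - vbar j| ≤ δ := by
  -- Along an ultrafilter the cluster point is a genuine limit, so limit algebra applies.
  obtain ⟨U, hU, hUlim⟩ := mapClusterPt_iff_ultrafilter.1 hlim
  have hvU : ∀ᶠ t in (U : Filter ℝ), v t ≠ 0 := hU hv
  have hnorm : ‖vbar‖ = 1 := by
    refine tendsto_nhds_unique hUlim.norm (tendsto_const_nhds.congr' ?_)
    filter_upwards [hvU] with t ht
    have : ‖v t‖ ≠ 0 := norm_ne_zero_iff.2 ht
    rw [norm_smul, norm_inv, norm_norm, inv_mul_cancel₀ this]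
  have hQ : Tendsto (fun t => ∑ j, (‖v t‖⁻¹ • v t) j ^ 2 * (β t j)⁻¹) U (𝓝 1) := by
    have h1 := tendsto_finsetSum Finset.univ fun j _ =>
      ((tendsto_coordinate hUlim j).pow 2).mul (((hβ j).mono_left hU).inv₀ one_ne_zero)
    simpa [← EuclideanSpace.real_norm_sq_eq, hnorm] using h1
  have hratio : Tendsto (fun t => ‖v t‖ * Real.exp (-logRadius β v t)) U (𝓝 1) := by
    have h1 : Tendsto (fun t => Real.exp (-(Real.log
        (∑ j, (‖v t‖⁻¹ • v t) j ^ 2 * (β t j)⁻¹) / 2))) U (𝓝 1) := by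
      have := ((hQ.log one_ne_zero).div_const 2).neg.rexp
      simpa using this
    refine h1.congr' ?_
    filter_upwards [hvU, hU (eventually_ge_atTop 0), hQ.eventually (lt_mem_nhds one_pos)]
      with t ht ht0 hpos
    have hn : 0 < ‖v t‖ := norm_pos_iff.2 ht
    have e : rescaledSq β v t = ‖v t‖ ^ 2 * ∑ j, (‖v t‖⁻¹ • v t) j ^ 2 * (β t j)⁻¹ := by
      rw [rescaledSq, Finset.mul_sum]
      refine Finset.sum_congr rfl fun j _ => ?_
      rw [exp_neg_log_rate (hβ0 t ht0 j), PiLp.smul_apply, smul_eq_mul]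
      field_simp
    rw [logRadius, e, Real.log_mul (by positivity) hpos.ne', Real.log_pow, add_div, neg_add,
      Real.exp_add, ← mul_assoc]
    push_cast
    rw [mul_div_cancel_left₀ _ two_ne_zero, Real.exp_neg (Real.log ‖v t‖), Real.exp_log hn,
      mul_inv_cancel₀ hn.ne', one_mul]
  have hfin : ∀ j, Tendsto (fun t => v t j * Real.exp (-logRadius β v t)) U (𝓝 (vbar j)) := by
    intro j
    have h1 := (tendsto_coordinate hUlim j).mul hratio
    rw [mul_one] at h1
    refine h1.congr' ?_
    filter_upwards [hvU] with t ht
    have : ‖v t‖ ≠ 0 := norm_ne_zero_iff.2 ht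
    rw [PiLp.smul_apply, smul_eq_mul]
    field_simp
  have hev : ∀ᶠ t in (U : Filter ℝ), ∀ j,
      |v t j * Real.exp (-logRadius β v t) - vbar j| ≤ δ := by
    refine eventually_all.2 fun j => ?_
    filter_upwards [(hfin j).eventually (Metric.ball_mem_nhds _ hδ)] with t ht
    rw [Real.dist_eq] at ht
    exact ht.le
  exact hev.frequently.filter_mono hU

end Flow

/-! ### From the flow to the margin dynamics -/

section MaxMargin

variable {p N : ℕ} {k : LossKind} {q : Fin N → Param p → ℝ} {β v ξ : ℝ → Param p} {L T : ℝ}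

/-- The error term `∫ ∑ⱼ |(log βⱼ)'|`. -/
noncomputable def rateDrift (β : ℝ → Param p) (T t : ℝ) : ℝ := ∫ s in T..t, rateVariation β s

theorem rateDrift_nonneg (β : ℝ → Param p) {T t : ℝ} (h : T ≤ t) : 0 ≤ rateDrift β T t :=
  intervalIntegral.integral_nonneg h fun _ _ => rateVariation_nonneg β _

theorem rateDrift_le {β : ℝ → Param p} {T t : ℝ} (hb : IntegrableOn (rateVariation β) (Ici T))
    (h : T ≤ t) : rateDrift β T t ≤ ∫ s in Ici T, rateVariation β s := by
  rw [rateDrift, intervalIntegral.integral_of_le h]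
  refine setIntegral_mono_set hb (Eventually.of_forall fun _ => rateVariation_nonneg β _) ?_
  exact (Ioc_subset_Icc_self.trans Icc_subset_Ici_self).eventuallyLE

theorem loss_antitoneOn (hN : 0 < N) (hq : ∀ i, LocallyLipschitz (q i))
    (hchain : ∀ i, AdmitsChainRule (q i)) (hv : ACFrom v T) (hβ : ∀ t, T ≤ t → ∀ j, 0 < β t j)
    (hξ : ∀ᵐ t ∂(volume.restrict (Ici T)), ξ t ∈ clarkeSubdiff (empLoss k q) (v t) ∧
      HasDerivAt v (-hadamard (β t) (ξ t)) t) :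
    AntitoneOn (fun t => empLoss k q (v t)) (Ici T) := by
  have hac : ACFrom (fun t => empLoss k q (v t)) T :=
    hv.lipschitz_comp fun t _ => locallyLipschitz_empLoss k hq (v t)
  have h := hac.neg.monotoneOn (by
    filter_upwards [hasDerivAt_empLoss_ae hN hq hchain hv hξ, ae_restrict_mem measurableSet_Ici]
      with t ht htT
    refine ⟨_, ?_, ht.neg⟩
    rw [neg_neg]
    exact Finset.sum_nonneg fun j _ => mul_nonneg (hβ t htT j).le (sq_nonneg _))
  intro s hs t ht hst
  exact neg_le_neg_iff.1 (h hs ht hst)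

/-- The scalar quantities attached to an adaptive gradient flow form a `MarginDynamics`. -/
theorem exists_marginDynamics (hN : 0 < N) (hq : ∀ i, LocallyLipschitz (q i))
    (hchain : ∀ i, AdmitsChainRule (q i)) (hL : 0 < L)
    (hhom : ∀ α : ℝ, 0 < α → ∀ i w, q i (α • w) = α ^ L * q i w)
    (hv : ACFrom v T) (hβ : ∀ t, T ≤ t → ∀ j, 1 / 2 ≤ β t j ∧ β t j ≤ 2)
    (hlog : ∀ j, ACFrom (fun t => Real.log (β t j)) T)
    (hb : IntegrableOn (rateVariation β) (Ici T))
    (hξ : ∀ᵐ t ∂(volume.restrict (Ici T)), ξ t ∈ clarkeSubdiff (empLoss k q) (v t) ∧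
      HasDerivAt v (-hadamard (β t) (ξ t)) t)
    (hS : ∀ t, T ≤ t → 0 < k.ellInv (empLoss k q (v t))) (hv0 : ∀ t, T ≤ t → v t ≠ 0) :
    ∃ M, MarginDynamics k L T M (∫ s in Ici T, rateVariation β s)
      (fun t => k.ellInv (empLoss k q (v t))) (logRadius β v) (rateDrift β T)
      (fun t => -inner ℝ (ξ t) (v t)) (fun t => ∑ j, β t j * ξ t j ^ 2) (rateVariation β) := by
  have hβ0 : ∀ t, T ≤ t → ∀ j, 0 < β t j := fun t ht j =>
    lt_of_lt_of_le (by norm_num) (hβ t ht j).1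
  have hn0 : ∀ t, T ≤ t → 0 < ‖v t‖ := fun t ht => norm_pos_iff.2 (hv0 t ht)
  have hQ : ∀ t, T ≤ t → 0 < rescaledSq β v t := fun t ht => by
    have := hn0 t ht
    exact lt_of_lt_of_le (by positivity) (rescaledSq_bounds (v := v) (hβ t ht)).1
  have hpos : ∀ t, 0 < empLoss k q (v t) := fun t => empLoss_pos hN k q _
  have hell : ∀ t, ∑ i, k.ell (q i (v t)) = k.ell (k.ellInv (empLoss k q (v t))) := fun t =>
    (k.ell_ellInv (hpos t)).symm
  obtain ⟨M, hM, hqM⟩ := exists_homogeneous_le (hq ⟨0, hN⟩).continuous hL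
    (fun α hα => hhom α hα ⟨0, hN⟩)
  -- `M` bounds one model on the unit sphere, and `2 ^ L` comes from `‖v‖ ≤ 2 e^R`.
  refine ⟨M * 2 ^ L, hL, by positivity, ?_, acFrom_logRadius hv hlog hQ, acFrom_integral hb, hS,
    fun t ht => ?_, fun t ht => rateDrift_nonneg β ht, fun t ht => rateDrift_le hb ht, ?_, ?_, ?_,
    ?_, ?_⟩
  · exact ACFrom.lipschitz_comp (f := fun t => empLoss k q (v t))
      (hv.lipschitz_comp fun t _ => locallyLipschitz_empLoss k hq (v t))
      fun t _ => (k.hasStrictDerivAt_ellInv (hpos t)).exists_lipschitzOnWith_nhds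
  · refine ((k.le_of_ell_sum_eq (hell t) ⟨0, hN⟩).trans (hqM _)).trans ?_
    rw [mul_assoc]
    refine mul_le_mul_of_nonneg_left ?_ hM.le
    have h1 := (norm_mul_exp_neg_logRadius_bounds (hv0 t ht) (hβ t ht)).2
    rw [Real.exp_neg, ← div_eq_mul_inv, div_le_iff₀ (Real.exp_pos _)] at h1
    rw [mul_comm L, Real.exp_mul, ← Real.mul_rpow two_pos.le (Real.exp_pos _).le]
    exact Real.rpow_le_rpow (norm_nonneg _) h1 hL.le
  · filter_upwards [hasDerivAt_empLoss_ae hN hq hchain hv hξ] with t ht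
    have := (k.hasStrictDerivAt_ellInv (hpos t)).hasDerivAt.comp t ht
    convert! this using 1
    ring
  · filter_upwards [ae_hasDerivAt_integral hb] with t ht
    exact ⟨rateVariation_nonneg β t, ht⟩
  · filter_upwards [hξ, ae_all_iff.2 fun j => (hlog j).ae_differentiableAt,
      ae_restrict_mem measurableSet_Ici] with t ht hd htT
    exact hasDerivAt_logRadius (hβ0 t htT) (hQ t htT) ht.2 hd
  · filter_upwards [hξ, ae_restrict_mem measurableSet_Ici] with t ht htT
    rw [inner_clarkeSubdiff_empLoss hN hq hchain hhom ht.1, neg_neg]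
    exact mul_le_mul_of_nonneg_left (k.weight_mul_le_sum (hS t htT) (hell t)) hL.le
  · filter_upwards [ae_restrict_mem measurableSet_Ici] with t htT
    rw [exp_neg_two_mul_logRadius (hQ t htT), ← div_eq_mul_inv, div_le_iff₀ (hQ t htT), mul_comm]
    exact sq_inner_le (ξ t) (hβ0 t htT)

/-- The margin bound makes `‖ξ‖` comparable to its radial part, so the normalized parameters cannot
rotate much faster than `R` and the rates change. -/
theorem ae_coordinate_speed_le (hN : 0 < N) (hq : ∀ i, LocallyLipschitz (q i))
    (hchain : ∀ i, AdmitsChainRule (q i)) (hL : 0 < L)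
    (hhom : ∀ α : ℝ, 0 < α → ∀ i w, q i (α • w) = α ^ L * q i w)
    (hβ : ∀ t, T ≤ t → ∀ j, 1 / 2 ≤ β t j ∧ β t j ≤ 2)
    (hlog : ∀ j, ACFrom (fun t => Real.log (β t j)) T)
    (hξ : ∀ᵐ t ∂(volume.restrict (Ici T)), ξ t ∈ clarkeSubdiff (empLoss k q) (v t) ∧
      HasDerivAt v (-hadamard (β t) (ξ t)) t)
    (hv0 : ∀ t, T ≤ t → v t ≠ 0) {c : ℝ} (hc : 0 < c)
    (hmargin : ∀ t, T ≤ t → ∀ i, c * Real.exp (logRadius β v t) ^ L ≤ q i (v t)) :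
    ∃ C : ℝ, 0 ≤ C ∧ ∀ j, ∀ᵐ t ∂(volume.restrict (Ici T)), ∃ d,
      |d| ≤ C * (-inner ℝ (ξ t) (v t) * Real.exp (-(2 * logRadius β v t)) + rateVariation β t) ∧
      HasDerivAt (fun t => v t j * Real.exp (-logRadius β v t)) d t := by
  obtain ⟨C, hC0, hC⟩ := exists_norm_clarkeSubdiff_empLoss_le (k := k) hN hq hchain hL hhom
    (c := c / 2 ^ L) (by positivity)
  -- `4 * C` bounds the contribution of `vⱼ'` and `2` that of `R'`, through `|vⱼ| e^{-R} ≤ 2`.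
  refine ⟨4 * C + 2, by positivity, fun j => ?_⟩
  filter_upwards [hξ, ae_all_iff.2 fun j => (hlog j).ae_differentiableAt,
    ae_restrict_mem measurableSet_Ici] with t ⟨hmem, hd⟩ hdl htT
  have hβ0 : ∀ j, 0 < β t j := fun j => lt_of_lt_of_le (by norm_num) (hβ t htT j).1
  have hn0 : 0 < ‖v t‖ := norm_pos_iff.2 (hv0 t htT)
  have hQ : 0 < rescaledSq β v t :=
    lt_of_lt_of_le (by positivity) (rescaledSq_bounds (v := v) (hβ t htT)).1
  obtain ⟨e, he, hR⟩ := hasDerivAt_logRadius hβ0 hQ hd hdl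
  obtain ⟨hb1, hb2⟩ := norm_mul_exp_neg_logRadius_bounds (hv0 t htT) (hβ t htT)
  refine ⟨_, ?_, (hasDerivAt_coordinate hd j).mul hR.neg.exp⟩
  set E := Real.exp (-logRadius β v t) with hE
  have hE0 : 0 < E := Real.exp_pos _
  have hE2 : Real.exp (-(2 * logRadius β v t)) = E * E := by
    rw [hE, ← Real.exp_add]; ring_nf
  have hnorm := hC (v t) (hv0 t htT) (fun i => by
    refine le_trans ?_ (hmargin t htT i)
    rw [div_mul_eq_mul_div, mul_div_assoc, ← Real.div_rpow hn0.le two_pos.le]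
    refine mul_le_mul_of_nonneg_left (Real.rpow_le_rpow (by positivity) ?_ hL.le) hc.le
    rw [hE, Real.exp_neg, ← div_eq_mul_inv, div_le_iff₀ (Real.exp_pos _)] at hb2
    linarith) (ξ t) hmem
  set n := -inner ℝ (ξ t) (v t) with hn
  have hnn : 0 ≤ n := by
    have h1 : 0 ≤ ∑ i, k.weight (q i (v t)) * q i (v t) := Finset.sum_nonneg fun i _ =>
      mul_nonneg (k.weight_pos _).le (le_trans (by positivity) (hmargin t htT i))
    rw [hn, inner_clarkeSubdiff_empLoss hN hq hchain hhom hmem, neg_neg]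
    positivity
  have hbn := rateVariation_nonneg β t
  have hξE : ‖ξ t‖ * E ≤ 2 * C * (n * (E * E)) := by
    have h1 : ‖ξ t‖ * E * 1 ≤ ‖ξ t‖ * E * (2 * (‖v t‖ * E)) := by
      refine mul_le_mul_of_nonneg_left ?_ (by positivity)
      linarith
    have h2 := mul_le_mul_of_nonneg_right hnorm (mul_pos hE0 hE0).le
    linarith
  have hvE : |v t j| * E ≤ 2 := by
    have : |v t j| ≤ ‖v t‖ := PiLp.norm_apply_le (v t) j
    nlinarith
  have hξj : |(-hadamard (β t) (ξ t)) j| ≤ 2 * ‖ξ t‖ := by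
    have h1 : |ξ t j| ≤ ‖ξ t‖ := PiLp.norm_apply_le (ξ t) j
    simp only [PiLp.neg_apply, hadamard, abs_neg, abs_mul, abs_of_pos (hβ0 j)]
    exact mul_le_mul (hβ t htT j).2 h1 (abs_nonneg _) two_pos.le
  have hRabs : |n * Real.exp (-(2 * logRadius β v t)) + e| ≤
      n * (E * E) + rateVariation β t / 2 := by
    rw [hE2]
    refine (abs_add_le _ _).trans (add_le_add (le_of_eq (abs_of_nonneg (by positivity))) he)
  have h1 := mul_le_mul_of_nonneg_right hξj hE0.le
  have h2 := mul_le_mul hvE hRabs (abs_nonneg _) two_pos.le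
  refine (abs_add_le _ _).trans ?_
  simp only [Pi.neg_apply, ← hE, abs_mul, abs_neg, abs_of_pos hE0] at h2 ⊢
  rw [hE2] at h2 ⊢
  nlinarith [mul_nonneg hC0 hbn]

end MaxMargin

end AdaptiveFlow

theorem mainTheorem1 {p N : ℕ} (k : LossKind) (q : Fin N → Param p → ℝ)
    (β v : ℝ → Param p)
    (hflow : IsAdaptiveGradientFlow (empLoss k q) β v)
    (hLip : ∀ i, LocallyLipschitz (q i))
    (hchain : ∀ i, AdmitsChainRule (q i))
    (hhom : ∃ L : ℝ, 0 < L ∧ ∀ α : ℝ, 0 < α → ∀ i w, q i (α • w) = α ^ L * q i w)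
    (hsep : ∃ t₀ : ℝ, 0 ≤ t₀ ∧ 0 < k.finv (Real.log (1 / empLoss k q (v t₀))))
    (vbar : Param p)
    (hlim : MapClusterPt vbar atTop (fun t : ℝ => ‖v t‖⁻¹ • v t)) :
    ∃ c : ℝ, 0 < c ∧ IsMaxMarginKKTPoint q (c • vbar) := by
  obtain ⟨L, hL, hhom⟩ := hhom
  obtain ⟨t₀, ht₀, hsep⟩ := hsep
  -- For `N = 0` the loss is 0, and the conventions `1 / 0 = 0` and `log 0 = 0` reduce separability
  -- to `0 < f⁻¹(0)`, false for both losses.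
  have hN : 0 < N := by
    rcases Nat.eq_zero_or_pos N with rfl | h
    · exfalso
      simp only [empLoss, Finset.univ_eq_empty, Finset.sum_empty, div_zero, Real.log_zero] at hsep
      cases k
      · simp [LossKind.finv] at hsep
      · simp only [LossKind.finv, neg_zero, Real.exp_zero] at hsep
        have := Real.log_nonneg (show 1 ≤ Real.exp 1 - 1 by linarith [Real.add_one_le_exp 1])
        linarith
    · exact h
  have hpos : ∀ t, 0 < empLoss k q (v t) := fun t => empLoss_pos hN k q _
  rw [k.finv_log_one_div (hpos t₀)] at hsep
  have hv : ACFrom v 0 := hflow.ac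
  have : (ae (volume.restrict (Ici (0 : ℝ)))).NeBot := by
    rw [ae_neBot, Ne, Measure.restrict_eq_zero]
    simp
  -- The selection need not be measurable: `ξ` enters only almost-everywhere statements and is never
  -- integrated.
  obtain ⟨ξ, hξ⟩ := hflow.flow.choice
  have hanti := loss_antitoneOn hN hLip hchain hv hflow.rate_pos hξ
  obtain ⟨T, hTt₀, hβ⟩ : ∃ T, t₀ ≤ T ∧ ∀ t, T ≤ t → ∀ j, 1 / 2 ≤ β t j ∧ β t j ≤ 2 := by
    have h : ∀ᶠ t in atTop, ∀ j, 1 / 2 ≤ β t j ∧ β t j ≤ 2 := eventually_all.2 fun j =>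
      ((hflow.rate_tendsto j).eventually (Icc_mem_nhds (by norm_num) (by norm_num)))
    obtain ⟨T, hT⟩ := eventually_atTop.1 h
    exact ⟨max t₀ T, le_max_left _ _, fun t ht => hT t ((le_max_right _ _).trans ht)⟩
  have hT : 0 ≤ T := ht₀.trans hTt₀
  have hS : ∀ t, T ≤ t → 0 < k.ellInv (empLoss k q (v t)) := fun t ht =>
    hsep.trans_le (k.ellInv_anti (hpos t) (hanti ht₀ (hT.trans ht : 0 ≤ t) (hTt₀.trans ht)))
  have hSq : ∀ t i, k.ellInv (empLoss k q (v t)) ≤ q i (v t) := fun t i =>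
    k.le_of_ell_sum_eq (k.ell_ellInv (hpos t)).symm i
  have hv0 : ∀ t, T ≤ t → v t ≠ 0 := fun t ht h0 => by
    have h1 := (hS t ht).trans_le (hSq t ⟨0, hN⟩)
    rw [h0, homogeneous_zero hL fun α hα => hhom α hα ⟨0, hN⟩] at h1
    exact lt_irrefl _ h1
  have hsub : Ici T ⊆ Ici (0 : ℝ) := Ici_subset_Ici.2 hT
  have hξT := ae_restrict_of_ae_restrict_of_subset hsub hξ
  have hlog : ∀ j, ACFrom (fun t => Real.log (β t j)) T := fun j =>
    ACFrom.mono (hflow.log_rate_ac j) hT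
  have hb : IntegrableOn (rateVariation β) (Ici T) :=
    integrable_finsetSum _ fun j _ => ((hflow.log_rate_integrable j).mono_set hsub).abs
  obtain ⟨M, hdyn⟩ := exists_marginDynamics hN hLip hchain hL hhom (hv.mono hT) hβ hlog hb hξT hS
    hv0
  obtain ⟨c, hc, hcS⟩ := hdyn.exists_margin_le
  have hmargin : ∀ t, T ≤ t → ∀ i, c * Real.exp (logRadius β v t) ^ L ≤ q i (v t) :=
    fun t ht i => by
      rw [← Real.exp_mul, mul_comm _ L]
      exact (hcS t ht).trans (hSq t i)
  obtain ⟨C, hC, hspeed⟩ := ae_coordinate_speed_le hN hLip hchain hL hhom hβ hlog hξT hv0 hc hmargin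
  have hu : ∀ j, ACFrom (fun t => v t j * Real.exp (-logRadius β v t)) T := fun j =>
    ((hv.mono hT).coordinate j).mul (hdyn.acR.neg.lipschitz_comp fun t _ =>
      (Real.hasStrictDerivAt_exp _).exists_lipschitzOnWith_nhds)
  have hclose := fun (δ : ℝ) (hδ : δ > 0) => frequently_rescaled_close hflow.rate_tendsto
    hflow.rate_pos ((eventually_ge_atTop T).mono hv0) hlim hδ
  -- Aligned times with tolerance `1 / (m + 1)`, taken after time `m`.
  choose t ht1 htT htP htu htA using fun m : ℕ =>
    hdyn.exists_aligned hu hC hspeed hclose (hξT.and hdyn.ae_n_pos)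
      (Nat.one_div_pos_of_nat (α := ℝ) (n := m)) m
  have ht : Tendsto t atTop atTop := tendsto_atTop_mono ht1 tendsto_natCast_atTop_atTop
  have hδ : Tendsto (fun m : ℕ => 1 / ((m : ℝ) + 1)) atTop (𝓝 0) :=
    tendsto_one_div_add_atTop_nhds_zero_nat
  have hulim : ∀ j, Tendsto (fun m => v (t m) j * Real.exp (-logRadius β v (t m))) atTop
      (𝓝 (vbar j)) := fun j => by
    rw [tendsto_iff_dist_tendsto_zero]
    exact squeeze_zero (fun _ => dist_nonneg) (fun m => htu m j) hδ
  refine exists_isMaxMarginKKTPoint_of_tendsto hN hLip hchain hL hhom hc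
    (x := fun m => v (t m)) (ξ := fun m => ξ (t m)) (r := fun m => Real.exp (logRadius β v (t m)))
    (fun m => Real.exp_pos _) (Real.tendsto_exp_atTop.comp (hdyn.tendsto_R.comp ht)) ?_
    (fun m i => hmargin _ (htT m) i) (fun m => (htP m).1.1) ?_
  · refine tendsto_of_coordinates fun j => (hulim j).congr fun m => ?_
    rw [PiLp.smul_apply, smul_eq_mul, Real.exp_neg, mul_comm]
  · refine tendsto_of_coordinates fun j => ?_
    have h1 : Tendsto (fun m => (β (t m) j)⁻¹ *
        (v (t m) j * Real.exp (-logRadius β v (t m)))) atTop (𝓝 (vbar j)) := by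
      simpa using (((hflow.rate_tendsto j).comp ht).inv₀ one_ne_zero).mul (hulim j)
    -- The alignment defect vanishes, so the normalized `ξ` inherits the limit of `β⁻¹ ⊙ v e^{-R}`.
    have h2 : Tendsto (fun m => (β (t m) j)⁻¹ * (v (t m) j * Real.exp (-logRadius β v (t m))) -
        Real.exp (logRadius β v (t m)) / inner ℝ (ξ (t m)) (v (t m)) * ξ (t m) j) atTop
        (𝓝 0) := by
      have hsq : Tendsto (fun m : ℕ => Real.sqrt (2 * (1 / ((m : ℝ) + 1)))) atTop (𝓝 0) := by
        simpa using (hδ.const_mul 2).sqrt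
      refine squeeze_zero_norm (fun m => Real.abs_le_sqrt ?_) hsq
      have hQ : 0 < rescaledSq β v (t m) := by
        have := norm_pos_iff.2 (hv0 _ (htT m))
        exact lt_of_lt_of_le (by positivity) (rescaledSq_bounds (v := v) (hβ _ (htT m))).1
      exact coordinate_defect_sq_le (fun j => (hβ _ (htT m) j).1) hQ (htP m).2 (htA m) j
    have h3 := h1.sub h2
    rw [sub_zero] at h3
    refine h3.congr fun m => ?_
    rw [PiLp.smul_apply, smul_eq_mul, sub_sub_cancel]
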